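/- **Definitions.** A *ranked set* is a finite set $S$ with a map $\mathrm{rank}\colon S\to\mathbb N$; $S^{(m)}$ is the set of its elements of rank $m$. Let $\Sigma$ be a ranked set of labels. A *graph* $G$ over $\Sigma$ has disjoint finite sets of nodes and edges; each edge $e$ has a label $\mathrm{lab}(e)\in\Sigma$ and is attached to a sequence of $\mathrm{rank}(\mathrm{lab}(e))$ nodes; moreover $G$ has two repetition-free sequences of nodes, $\mathrm{front}_G$ and $\mathrm{rear}_G$. Its *type* is $(|\mathrm{front}_G|,|\mathrm{rear}_G|)$. Let $\mathbb G^{(i,j)}$ be the set of graphs of type $(i,j)$ and $\mathbb G^m=\bigcup_n\mathbb G^{(m,n)}$. If $\mathrm{rear}_G=\mathrm{front}_H$, and $G$, $H$ share exactly the nodes in this sequence and no edges, then $G\cdot H$ is their union with front $\mathrm{front}_G$ and rear $\mathrm{rear}_H$ (isomorphic copies are used otherwise). *Graph expressions* of type $(i,j)$ and their languages, taken up to isomorphism, are: $\varnothing$ with $L(\varnothing)=\varnothing$; a single graph $G\in\mathbb G^{(i,j)}$ with $L(G)=\{G\}$; $ex_1\oplus ex_2$, denoting the union, for $ex_1,ex_2$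 of type $(i,j)$; $ex_1\odot ex_2$, denoting $\{G\cdot H\mid G\in L(ex_1),H\in L(ex_2)\}$, for $ex_1$ of type $(i,k)$ and $ex_2$ of type $(k,j)$; and, if $i=j$, $ex^{\circledast}$ for $ex$ of type $(i,i)$, denoting the smallest language that contains the identity graph on $i$ nodes (no edges, nodes exactly the interface nodes, front $=$ rear) and all $G\cdot H$ with $G\in L(ex)$, $H\in L(ex^{\circledast})$. A graph $P$ is a *frontal subgraph* of $H$ if its nodes and edges are nodes and edges of $H$ with the same labels and attachments, $\mathrm{front}_P=\mathrm{front}_H$, and every node of $P$ in $\mathrm{rear}_H$ is in $\mathrm{rear}_P$. Then $H\setminus\!\!\setminus P$ is obtained from $H$ by removing the nodes of $P$ not in $\mathrm{rear}_P$, the edges of $P$, and all edges attached to a removed node; its front is $\mathrm{rear}_P$ and its rear is $\mathrm{rear}_H$. Let $X$ be a ranked set of variables. *Formulas* of type $m$ over $\Sigma$ and $X$ are: $\mathit{true}$, $\mathit{false}$; the variables in $X^{(m)}$; $\exists(ex,\varphi)$ and $\forall(ex,\varphi)$ for an expression $ex$ of type $(m,i)$ and a formula $\varphi$ of type $i$;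 and $\neg\varphi$, $\varphi\wedge\psi$, $\varphi\vee\psi$ for formulas $\varphi,\psi$ of type $m$. The formulas $\mathit{true}$, $\varphi\wedge\psi$ and $\forall(ex,\varphi)$ are *conjunctive*, all others *disjunctive*. A *formula system* $F$ over $X$ assigns to each $x\in X$ a formula $F(x)$ of type $\mathrm{rank}(x)$. A *configuration* is a triple $(\varphi,G,s)$ of a formula $\varphi$ of type $m$, a graph $G\in\mathbb G^m$ and a sign $s\in\{\mathrm{pos},\mathrm{neg}\}$, for some $m$. It is *universal* if $s=\mathrm{pos}$ and $\varphi$ is conjunctive, or $s=\mathrm{neg}$ and $\varphi$ is disjunctive; otherwise it is *existential*. Its successors are: for $(\neg\varphi,G,s)$, the configuration $(\varphi,G,\bar s)$ with the opposite sign; for $\varphi\wedge\psi$ and $\varphi\vee\psi$, both $(\varphi,G,s)$ and $(\psi,G,s)$; for $\exists(ex,\varphi)$ and $\forall(ex,\varphi)$, all $(\varphi,G\setminus\!\!\setminus P,s)$ with $P\in L(ex)$ a frontal subgraph of $G$; for a variable $x$, the configuration $(F(x),G,s)$; for $\mathit{true}$ and $\mathit{false}$, none. For $x\in X$ and $G\in\mathbb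 G^{\mathrm{rank}(x)}$, consider the graph of all configurations that are reachable from $(x,G,\mathrm{pos})$. Start with all truth values undefined and repeat the following simultaneously at all configurations: a universal configuration becomes true if all its successors are true, and false if some successor is false; an existential one becomes true if some successor is true, and false if all its successors are false; otherwise the value stays as it is. The assignment in which this stabilizes is the least fixed point. $G$ is *accepted* (*rejected*) by $F$ at $x$ if $(x,G,\mathrm{pos})$ is true (false) in it. The *lower language* $\underline L_x(F)$ is the set of all $G\in\mathbb G^{\mathrm{rank}(x)}$ accepted by $F$ at $x$; the *upper language* $\overline L_x(F)$ is the set of all $G\in\mathbb G^{\mathrm{rank}(x)}$ not rejected by $F$ at $x$. **Theorem (Shallow Normal Form).** For every formula system $F$ over a ranked set $X$ of variables (and $\Sigma$) there are a ranked set $X'\supseteq X$, whose rank function extends that of $X$, and a formula system $F'$ over $X'$ (and $\Sigma$) such that 1. $\underline L_x(F')=\underline L_x(F)$ and $\overline L_x(F')=\overline L_x(F)$ for all $x\in X$, and 2. for every $x\in X'$, $F'(x)$ has one of the forms $\mathit{true}$, $\mathit{false}$, $x'\vee x''$, $x'\wedge x''$, $\exists(G,x')$, $\forall(G,x')$, where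 $G$ is a single graph over $\Sigma$ and $x',x''\in X'$. -/

import Mathlib

universe u v

namespace GraphFormula

/-- A ranked set: a finite set together with a rank function. -/
structure RankedSet where
  carrier : Type u
  [finite : Finite carrier]
  rank : carrier → ℕ

instance : CoeSort RankedSet.{u} (Type u) := ⟨RankedSet.carrier⟩

instance (S : RankedSet.{u}) : Finite S := S.finite

/-! ### Graphs -/

/-- A finite edge-labelled hypergraph with front and rear interface. Node names and edge names are
taken from two separate copies of `ℕ`, so that node and edge sets are disjoint; every finite
graph has an isomorphic copy of this kind. -/
structure Graph (Voc : RankedSet.{u}) where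
  nodes : Finset ℕ
  edges : Finset ℕ
  att : {e // e ∈ edges} → List ℕ
  lab : {e // e ∈ edges} → Voc
  front : List ℕ
  rear : List ℕ
  att_mem : ∀ e, ∀ v ∈ att e, v ∈ nodes
  att_length : ∀ e, (att e).length = Voc.rank (lab e)
  front_mem : ∀ v ∈ front, v ∈ nodes
  rear_mem : ∀ v ∈ rear, v ∈ nodes
  front_nodup : front.Nodup
  rear_nodup : rear.Nodup

variable {Voc : RankedSet.{u}}

/-- Graphs of type `(i, j)`. -/
abbrev TGraph (Voc : RankedSet.{u}) (i j : ℕ) : Type u :=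
  {G : Graph Voc // G.front.length = i ∧ G.rear.length = j}

/-- Graphs of type `(m, n)` for some `n`. -/
abbrev FGraph (Voc : RankedSet.{u}) (m : ℕ) : Type u :=
  {G : Graph Voc // G.front.length = m}

namespace Graph

/-- Isomorphism of graphs; interfaces are preserved. -/
def Iso (G H : Graph Voc) : Prop :=
  ∃ (φ : ℕ → ℕ) (ψ : {e // e ∈ G.edges} ≃ {e // e ∈ H.edges}),
    Set.BijOn φ (G.nodes : Set ℕ) (H.nodes : Set ℕ) ∧
    (∀ e, H.lab (ψ e) = G.lab e ∧ H.att (ψ e) = (G.att e).map φ) ∧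
    H.front = G.front.map φ ∧ H.rear = G.rear.map φ

/-- Identity graphs: no edges, equal interfaces, and no nodes but the interface nodes. -/
def IsIdentity (G : Graph Voc) : Prop :=
  G.edges = ∅ ∧ G.front = G.rear ∧ ∀ v ∈ G.nodes, v ∈ G.front

/-- `C` is the concatenation `G · H` of graphs that share precisely the nodes of the interface
`rear G = front H`, and no edges. -/
structure IsConcat (G H C : Graph Voc) : Prop where
  interface : G.rear = H.front
  inter : ∀ v, (v ∈ G.nodes ∧ v ∈ H.nodes) ↔ v ∈ G.rear
  disj : Disjoint G.edges H.edges
  nodes_eq : C.nodes = G.nodes ∪ H.nodes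
  edges_eq : C.edges = G.edges ∪ H.edges
  left : ∀ e (h : e ∈ G.edges) (hC : e ∈ C.edges),
    C.att ⟨e, hC⟩ = G.att ⟨e, h⟩ ∧ C.lab ⟨e, hC⟩ = G.lab ⟨e, h⟩
  right : ∀ e (h : e ∈ H.edges) (hC : e ∈ C.edges),
    C.att ⟨e, hC⟩ = H.att ⟨e, h⟩ ∧ C.lab ⟨e, hC⟩ = H.lab ⟨e, h⟩
  front_eq : C.front = G.front
  rear_eq : C.rear = H.rear

/-- `P` is a frontal subgraph of `H`. -/
structure IsFrontal (P H : Graph Voc) : Prop where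
  nodes_sub : P.nodes ⊆ H.nodes
  edges_sub : P.edges ⊆ H.edges
  edge_eq : ∀ e (h : e ∈ P.edges) (hH : e ∈ H.edges),
    P.lab ⟨e, h⟩ = H.lab ⟨e, hH⟩ ∧ P.att ⟨e, h⟩ = H.att ⟨e, hH⟩
  front_eq : P.front = H.front
  rear_mem : ∀ v ∈ P.nodes, v ∈ H.rear → v ∈ P.rear

open Classical in
/-- Cutting a frontal subgraph `P` off `H`: remove the nodes of `P` outside its rear interface,
the edges of `P`, and all edges attached to a removed node. -/
noncomputable def cut (H P : Graph Voc) (h : IsFrontal P H) : Graph Voc where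
  nodes := H.nodes.filter fun v => ¬ (v ∈ P.nodes ∧ v ∉ P.rear)
  edges := H.edges.filter fun e =>
    e ∉ P.edges ∧ ∀ he : e ∈ H.edges, ∀ v ∈ H.att ⟨e, he⟩, ¬ (v ∈ P.nodes ∧ v ∉ P.rear)
  att := fun e => H.att ⟨e.1, (Finset.mem_filter.1 e.2).1⟩
  lab := fun e => H.lab ⟨e.1, (Finset.mem_filter.1 e.2).1⟩
  front := P.rear
  rear := H.rear
  att_mem := fun e v hv => Finset.mem_filter.2
    ⟨H.att_mem _ v hv, (Finset.mem_filter.1 e.2).2.2 (Finset.mem_filter.1 e.2).1 v hv⟩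
  att_length := fun _ => H.att_length _
  front_mem := fun v hv => Finset.mem_filter.2
    ⟨h.nodes_sub (P.rear_mem v hv), fun hn => hn.2 hv⟩
  rear_mem := fun v hv => Finset.mem_filter.2
    ⟨H.rear_mem v hv, fun hn => hn.2 (h.rear_mem v hn.1 hv)⟩
  front_nodup := P.rear_nodup
  rear_nodup := H.rear_nodup

end Graph

/-! ### Graph expressions -/

/-- Graph expressions of type `(i, j)`. -/
inductive GExpr (Voc : RankedSet.{u}) : ℕ → ℕ → Type u
  | empty {i j : ℕ} : GExpr Voc i j
  | graph {i j : ℕ} (G : TGraph Voc i j) : GExpr Voc i j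
  | union {i j : ℕ} (e₁ e₂ : GExpr Voc i j) : GExpr Voc i j
  | concat {i j k : ℕ} (e₁ : GExpr Voc i j) (e₂ : GExpr Voc j k) : GExpr Voc i k
  | star {i : ℕ} (e : GExpr Voc i i) : GExpr Voc i i

/-- Typed concatenation of graph languages. -/
def langConcat {i j k : ℕ} (L : Set (TGraph Voc i j)) (M : Set (TGraph Voc j k)) :
    Set (TGraph Voc i k) :=
  {C | ∃ G ∈ L, ∃ H ∈ M, Graph.IsConcat G.1 H.1 C.1}

/-- Kleene star of a graph language: the smallest language that contains the identity graphs of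
its type and all concatenations of a member of `L` with a member of the star. -/
inductive LangStar {i : ℕ} (L : Set (TGraph Voc i i)) : TGraph Voc i i → Prop
  | one (G : TGraph Voc i i) (hG : G.1.IsIdentity) : LangStar L G
  | cons (G H C : TGraph Voc i i) (hG : G ∈ L) (hH : LangStar L H)
      (hC : Graph.IsConcat G.1 H.1 C.1) : LangStar L C

/-- The language of a graph expression. As usual, graphs are taken up to isomorphism here: the
languages contain all isomorphic copies (with nodes and edges in `ℕ`) of their members. -/
def GExpr.lang : {i j : ℕ} → GExpr Voc i j → Set (TGraph Voc i j)
  | _, _, .empty => ∅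
  | _, _, .graph G => {H | Graph.Iso G.1 H.1}
  | _, _, .union e₁ e₂ => e₁.lang ∪ e₂.lang
  | _, _, .concat e₁ e₂ => langConcat e₁.lang e₂.lang
  | _, _, .star e => {H | LangStar e.lang H}

/-! ### Formulas and formula systems -/

/-- Graph formulas with variables, of type `m`. -/
inductive Formula (Voc : RankedSet.{u}) (X : RankedSet.{v}) : ℕ → Type (max u v)
  | tru {m : ℕ} : Formula Voc X m
  | fls {m : ℕ} : Formula Voc X m
  | var {m : ℕ} (x : X) (hx : X.rank x = m) : Formula Voc X m
  | ex {m i : ℕ} (e : GExpr Voc m i) (f : Formula Voc X i) : Formula Voc X m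
  | all {m i : ℕ} (e : GExpr Voc m i) (f : Formula Voc X i) : Formula Voc X m
  | neg {m : ℕ} (f : Formula Voc X m) : Formula Voc X m
  | and {m : ℕ} (f g : Formula Voc X m) : Formula Voc X m
  | or {m : ℕ} (f g : Formula Voc X m) : Formula Voc X m

variable {X : RankedSet.{v}}

/-- Conjunctive formulas; all others are disjunctive. -/
def Formula.Conjunctive : {m : ℕ} → Formula Voc X m → Prop
  | _, .tru => True
  | _, .and _ _ => True
  | _, .all _ _ => True
  | _, _ => False

/-- A system of graph formulas with variables. -/
abbrev FormulaSystem (Voc : RankedSet.{u}) (X : RankedSet.{v}) : Type (max u v) :=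
  (x : X) → Formula Voc X (X.rank x)

/-! ### Evaluation graphs -/

/-- An evaluation graph: a directed graph whose nodes are universal or existential. -/
structure EvalGraph where
  Node : Type u
  Universal : Node → Prop
  Edge : Node → Node → Prop

namespace EvalGraph

/-- Partial truth assignments. -/
abbrev Assignment (E : EvalGraph.{u}) : Type u := E.Node → Option Bool

open Classical in
/-- The truth assignment into which `α` evolves directly. -/
noncomputable def evo (E : EvalGraph.{u}) (α : E.Assignment) : E.Assignment := fun c =>
  if E.Universal c then
    if ∀ c', E.Edge c c' → α c' = some true then some true
    else if ∃ c', E.Edge c c' ∧ α c' = some false then some false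
    else α c
  else
    if ∀ c', E.Edge c c' → α c' = some false then some false
    else if ∃ c', E.Edge c c' ∧ α c' = some true then some true
    else α c

/-- The `n`-th assignment in the evolution of the completely undefined one. -/
noncomputable def iter (E : EvalGraph.{u}) (n : ℕ) : E.Assignment :=
  E.evo^[n] (fun _ => none)

open Classical in
/-- The assignment reached by evolution from the completely undefined one: a node has a value as
soon as some assignment in the sequence gives it one. On evaluation graphs with finitely many
edges leaving each node, this is the least fixed point of `evo`, see `evoStar_isLeast` below. -/
noncomputable def evoStar (E : EvalGraph.{u}) : E.Assignment := fun c =>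
  if h : ∃ n, E.iter n c ≠ none then E.iter (Nat.find h) c else none

/-- The condition under which `c` receives the value `b` in the evolution of `α`. -/
def Forces (E : EvalGraph.{u}) (α : E.Assignment) (c : E.Node) : Bool → Prop
  | true => (E.Universal c ∧ ∀ c', E.Edge c c' → α c' = some true) ∨
      (¬ E.Universal c ∧ ∃ c', E.Edge c c' ∧ α c' = some true)
  | false => (E.Universal c ∧ ∃ c', E.Edge c c' ∧ α c' = some false) ∨
      (¬ E.Universal c ∧ ∀ c', E.Edge c c' → α c' = some false)

theorem Forces.mono {E : EvalGraph.{u}} {α β : E.Assignment} {c : E.Node} {b : Bool}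
    (hαβ : ∀ c b, α c = some b → β c = some b) (h : E.Forces α c b) : E.Forces β c b := by
  cases b <;> simp only [Forces] at h ⊢ <;> grind

theorem Forces.evo_eq {E : EvalGraph.{u}} {α : E.Assignment} {c : E.Node} {b : Bool}
    (h : E.Forces α c b) : E.evo α c = some b := by
  cases b <;> simp only [Forces] at h <;> unfold evo <;> grind

theorem forces_or_eq_of_evo_eq {E : EvalGraph.{u}} {α : E.Assignment} {c : E.Node} {b : Bool}
    (h : E.evo α c = some b) : E.Forces α c b ∨ α c = some b := by
  unfold evo at h
  cases b <;> simp only [Forces] <;> split_ifs at h <;> grind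

theorem iter_succ (E : EvalGraph.{u}) (n : ℕ) : E.iter (n + 1) = E.evo (E.iter n) := by
  simp only [iter, Function.iterate_succ_apply']

theorem iter_forces (E : EvalGraph.{u}) (n : ℕ) :
    ∀ c b, E.iter n c = some b → E.Forces (E.iter n) c b := by
  induction n with
  | zero => intro c b h; simp [iter] at h
  | succ n ih =>
    intro c b h
    rw [iter_succ] at h ⊢
    have h1 : E.Forces (E.iter n) c b := (forces_or_eq_of_evo_eq h).elim id (ih c b)
    exact h1.mono fun c b hc => (ih c b hc).evo_eq

theorem iter_mono (E : EvalGraph.{u}) {m n : ℕ} (hmn : m ≤ n) {c : E.Node} {b : Bool}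
    (h : E.iter m c = some b) : E.iter n c = some b := by
  induction n, hmn using Nat.le_induction with
  | base => exact h
  | succ n _ ih => rw [iter_succ]; exact (E.iter_forces n c b ih).evo_eq

theorem evoStar_eq_some {E : EvalGraph.{u}} {c : E.Node} {b : Bool} :
    E.evoStar c = some b ↔ ∃ n, E.iter n c = some b := by
  classical
  unfold evoStar
  constructor
  · intro h
    split_ifs at h with h1
    exact ⟨_, h⟩
  · rintro ⟨n, hn⟩
    have h1 : ∃ n, E.iter n c ≠ none := ⟨n, by simp [hn]⟩
    rw [dif_pos h1]
    obtain ⟨b', hb'⟩ := Option.ne_none_iff_exists'.1 (Nat.find_spec h1)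
    have := E.iter_mono (Nat.find_min' h1 (m := n) (by simp [hn])) hb'
    rw [hb', ← this, hn]

/-- If only finitely many edges leave each node, then the assignment reached by evolution is a
fixed point, and it is the smallest one. -/
theorem evoStar_isLeast (E : EvalGraph.{u}) (hE : ∀ c, {c' | E.Edge c c'}.Finite) :
    E.evo E.evoStar = E.evoStar ∧
      ∀ α : E.Assignment, E.evo α = α → ∀ c b, E.evoStar c = some b → α c = some b := by
  have key : ∀ c b, E.Forces E.evoStar c b → E.evoStar c = some b := by
    intro c b h
    have hall : ∀ b', (∀ c', E.Edge c c' → E.evoStar c' = some b') →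
        ∃ n, ∀ c', E.Edge c c' → E.iter n c' = some b' := by
      intro b' hb'
      have h2 : ∀ c', ∃ n, E.Edge c c' → E.iter n c' = some b' := by
        intro c'
        by_cases hc : E.Edge c c'
        · obtain ⟨n, hn⟩ := evoStar_eq_some.1 (hb' c' hc)
          exact ⟨n, fun _ => hn⟩
        · exact ⟨0, fun h => absurd h hc⟩
      choose f hf using h2
      obtain ⟨N, hN⟩ := ((hE c).image f).bddAbove
      exact ⟨N, fun c' hc => E.iter_mono (hN ⟨c', hc, rfl⟩) (hf c' hc)⟩
    have : ∃ n, E.Forces (E.iter n) c b := by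
      cases b <;> simp only [Forces] at h ⊢
      · rcases h with ⟨hu, c', hc, hv⟩ | ⟨hu, hv⟩
        · obtain ⟨n, hn⟩ := evoStar_eq_some.1 hv
          exact ⟨n, Or.inl ⟨hu, c', hc, hn⟩⟩
        · obtain ⟨n, hn⟩ := hall _ hv
          exact ⟨n, Or.inr ⟨hu, hn⟩⟩
      · rcases h with ⟨hu, hv⟩ | ⟨hu, c', hc, hv⟩
        · obtain ⟨n, hn⟩ := hall _ hv
          exact ⟨n, Or.inl ⟨hu, hn⟩⟩
        · obtain ⟨n, hn⟩ := evoStar_eq_some.1 hv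
          exact ⟨n, Or.inr ⟨hu, c', hc, hn⟩⟩
    obtain ⟨n, hn⟩ := this
    exact evoStar_eq_some.2 ⟨n + 1, by rw [iter_succ]; exact hn.evo_eq⟩
  have iter_le : ∀ (α : E.Assignment), E.evo α = α → ∀ n c b, E.iter n c = some b →
      α c = some b := by
    intro α hα n
    induction n with
    | zero => intro c b h; simp [iter] at h
    | succ n ih =>
      intro c b h
      rw [iter_succ] at h
      rcases forces_or_eq_of_evo_eq h with h1 | h1
      · rw [← hα]; exact (h1.mono ih).evo_eq
      · exact ih c b h1
  refine ⟨funext fun c => ?_, fun α hα c b h => ?_⟩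
  · rcases ho : E.evoStar c with _ | b
    · rcases he : E.evo E.evoStar c with _ | b
      · rfl
      · rcases forces_or_eq_of_evo_eq he with h1 | h1
        · rw [key c b h1] at ho; cases ho
        · rw [ho] at h1; cases h1
    · obtain ⟨n, hn⟩ := evoStar_eq_some.1 ho
      exact ((E.iter_forces n c b hn).mono fun c b h => evoStar_eq_some.2 ⟨n, h⟩).evo_eq
  · obtain ⟨n, hn⟩ := evoStar_eq_some.1 h
    exact iter_le α hα n c b hn

end EvalGraph

/-! ### Formula configuration graphs and languages -/

inductive Sign
  | pos
  | neg

def Sign.flip : Sign → Sign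
  | .pos => .neg
  | .neg => .pos

/-- Formula configurations. -/
structure Config (Voc : RankedSet.{u}) (X : RankedSet.{v}) where
  type : ℕ
  formula : Formula Voc X type
  graph : FGraph Voc type
  sign : Sign

/-- Universal configurations; all others are existential. -/
def Config.Universal (c : Config Voc X) : Prop :=
  (c.sign = .pos ∧ c.formula.Conjunctive) ∨ (c.sign = .neg ∧ ¬ c.formula.Conjunctive)

/-- Steps between formula configurations. -/
def Step (F : FormulaSystem Voc X) : Config Voc X → Config Voc X → Prop
  | ⟨_, .tru, _, _⟩, _ => False
  | ⟨_, .fls, _, _⟩, _ => False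
  | ⟨_, .var x hx, G, s⟩, c' => c' = ⟨X.rank x, F x, ⟨G.1, G.2.trans hx.symm⟩, s⟩
  | ⟨m, .ex (i := i) e f, G, s⟩, c' => ∃ (P : TGraph Voc m i) (h : P.1.IsFrontal G.1),
      P ∈ e.lang ∧ c' = ⟨i, f, ⟨G.1.cut P.1 h, P.2.2⟩, s⟩
  | ⟨m, .all (i := i) e f, G, s⟩, c' => ∃ (P : TGraph Voc m i) (h : P.1.IsFrontal G.1),
      P ∈ e.lang ∧ c' = ⟨i, f, ⟨G.1.cut P.1 h, P.2.2⟩, s⟩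
  | ⟨m, .neg f, G, s⟩, c' => c' = ⟨m, f, G, s.flip⟩
  | ⟨m, .and f g, G, s⟩, c' => c' = ⟨m, f, G, s⟩ ∨ c' = ⟨m, g, G, s⟩
  | ⟨m, .or f g, G, s⟩, c' => c' = ⟨m, f, G, s⟩ ∨ c' = ⟨m, g, G, s⟩

/-- The initial configuration `(x, G, pos)`. -/
def initConfig (x : X) (G : FGraph Voc (X.rank x)) : Config Voc X :=
  ⟨X.rank x, .var x rfl, G, .pos⟩

/-- The formula configuration graph of `F` at `x` for the input graph `G`: its nodes are the
configurations that can be reached from the initial one, its edges are the steps. -/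
def FCG (F : FormulaSystem Voc X) (x : X) (G : FGraph Voc (X.rank x)) : EvalGraph where
  Node := {c : Config Voc X // Relation.ReflTransGen (Step F) (initConfig x G) c}
  Universal := fun c => c.1.Universal
  Edge := fun c c' => Step F c.1 c'.1

/-- The value of the initial configuration in its formula configuration graph; `none` if it
is undefined. -/
noncomputable def value (F : FormulaSystem Voc X) (x : X) (G : FGraph Voc (X.rank x)) :
    Option Bool :=
  (FCG F x G).evoStar ⟨initConfig x G, Relation.ReflTransGen.refl⟩

/-- The lower language accepted by `F` at `x`: all graphs that are accepted. -/
def lowerLang (F : FormulaSystem Voc X) (x : X) : Set (Graph Voc) :=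
  {G | ∃ h : G.front.length = X.rank x, value F x ⟨G, h⟩ = some true}

/-- The upper language accepted by `F` at `x`: all graphs that are not rejected. -/
def upperLang (F : FormulaSystem Voc X) (x : X) : Set (Graph Voc) :=
  {G | ∃ h : G.front.length = X.rank x, value F x ⟨G, h⟩ ≠ some false}

/-- The forms that shallow normal form allows: `true`, `false`, `x' ∨ x''`, `x' ∧ x''`,
`∃(G, x')` and `∀(G, x')`, where `G` is a single graph and `x'`, `x''` are variables. -/
inductive Formula.IsShallow : {m : ℕ} → Formula Voc X m → Prop
  | tru {m : ℕ} : IsShallow (Formula.tru (m := m))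
  | fls {m : ℕ} : IsShallow (Formula.fls (m := m))
  | or {m : ℕ} (x' x'' : X) (h' : X.rank x' = m) (h'' : X.rank x'' = m) :
      IsShallow (.or (.var x' h') (.var x'' h''))
  | and {m : ℕ} (x' x'' : X) (h' : X.rank x' = m) (h'' : X.rank x'' = m) :
      IsShallow (.and (.var x' h') (.var x'' h''))
  | ex {m i : ℕ} (G : TGraph Voc m i) (x' : X) (h' : X.rank x' = i) :
      IsShallow (.ex (.graph G) (.var x' h'))
  | all {m i : ℕ} (G : TGraph Voc m i) (x' : X) (h' : X.rank x' = i) :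
      IsShallow (.all (.graph G) (.var x' h'))

end GraphFormula

/-!
A formula system is brought into shallow normal form by taking signed formulas as variables and
letting each of them abbreviate the first step of its evaluation. A negative sign dualizes a
formula, which disposes of negation. A quantifier over a composite expression is unfolded along the
structure of the expression: `∃(e₁ ⊙ e₂, φ)` becomes `∃(e₁, ∃(e₂, φ))`, and `∃(e*, φ)` becomes
`φ ∨ ∃(e, ∃(e*, φ))`, as in Antimirov's partial derivatives of regular expressions. Only finitely
many signed formulas arise in this way (`exists_finite_closed`). The unfolding is correct because
cutting along an expression is a relation on graphs that turns the operations on expressions into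
union, composition and reflexive transitive closure of relations (`cuts_union`, `cuts_concat`,
`cuts_star`).

The obstacle is that the language of `e` may contain graphs whose cut removes nothing from the
graph and just rearranges the interface. Unfolding `e*` then runs in circles, and a configuration
that should be false remains undefined. Therefore expressions are normalized first. A cut that
removes nothing is determined by the injective map from the old interface positions to the new ones,
its pattern, and the language of `e` contains all or none of the graphs with a given pattern
(`Cuts.exists_pattern`). So the inert part of `e` is equivalent to a finite union of single graphs,
`e.inert`. The remaining part `e.proper` is obtained by recursion; for a star it is
`S N (S N)* S`, where `N` is the proper part of `e` and `S` the inert part of `e*`. In the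
normalized expression every iterated subexpression removes a node or an edge in each cut, and so
induction on the size of the graph shows that the unfolding of a star terminates
(`val_shapeGraph_of_branch`).

Truth values are handled by means of the inductive predicate `EvalGraph.Val`, which agrees with the
evolution of assignments since configurations have finitely many successors. Equality of the values
in two evaluation graphs is proved by showing for each of them that the values in the other are
closed under its rules, so that true, false and undefined configurations correspond exactly.
-/

namespace GraphFormula

variable {Voc : RankedSet.{u}} {X : RankedSet.{v}}

/-! ### Inductive values in evaluation graphs -/

namespace EvalGraph

/-- The value `b` is forced at `c` if `P` holds of the successors of `c` with this value: of all of
them if `c` is universal and `b` is true, or `c` is existential and `b` is false; and of some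
successor otherwise. -/
def Forced (E : EvalGraph.{u}) (P : E.Node → Bool → Prop) (c : E.Node) (b : Bool) : Prop :=
  ((E.Universal c ↔ b = true) ∧ ∀ c', E.Edge c c' → P c' b) ∨
    (¬ (E.Universal c ↔ b = true) ∧ ∃ c', E.Edge c c' ∧ P c' b)

/-- `E.Val c b`: the node `c` receives the value `b` after possibly transfinitely many rounds of
evolution. -/
inductive Val (E : EvalGraph.{u}) : E.Node → Bool → Prop
  | all {c : E.Node} {b : Bool} (hu : E.Universal c ↔ b = true)
      (h : ∀ c', E.Edge c c' → Val E c' b) : Val E c b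
  | some {c : E.Node} {b : Bool} (hu : ¬ (E.Universal c ↔ b = true)) (c' : E.Node)
      (hc : E.Edge c c') (h : Val E c' b) : Val E c b

theorem val_iff_forced {E : EvalGraph.{u}} {c : E.Node} {b : Bool} :
    E.Val c b ↔ E.Forced E.Val c b := by
  constructor
  · rintro (⟨hu, h⟩ | ⟨hu, c', hc, h⟩)
    exacts [Or.inl ⟨hu, h⟩, Or.inr ⟨hu, c', hc, h⟩]
  · rintro (⟨hu, h⟩ | ⟨hu, c', hc, h⟩)
    exacts [.all hu h, .some hu c' hc h]

theorem Val.least {E : EvalGraph.{u}} {P : E.Node → Bool → Prop}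
    (hP : ∀ c b, E.Forced P c b → P c b) {c : E.Node} {b : Bool} (h : E.Val c b) : P c b := by
  induction h with
  | all hu _ ih => exact hP _ _ (Or.inl ⟨hu, ih⟩)
  | some hu c' hc _ ih => exact hP _ _ (Or.inr ⟨hu, c', hc, ih⟩)

/-- Values are preserved and reflected by bounded morphisms. -/
theorem val_map {E : EvalGraph.{u}} {E' : EvalGraph.{v}} (h : E.Node → E'.Node)
    (hu : ∀ c, E'.Universal (h c) ↔ E.Universal c)
    (he : ∀ c d, E'.Edge (h c) d ↔ ∃ c', E.Edge c c' ∧ h c' = d) (c : E.Node) (b : Bool) :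
    E'.Val (h c) b ↔ E.Val c b := by
  constructor
  · intro hv
    suffices H : ∀ d b, E'.Val d b → ∀ c, h c = d → E.Val c b from H _ _ hv c rfl
    intro d b hd
    induction hd with
    | all hu' _ ih =>
      rintro c rfl
      exact .all ((hu c).symm.trans hu') fun c' hc => ih _ ((he _ _).2 ⟨c', hc, rfl⟩) c' rfl
    | some hu' d' hd' _ ih =>
      rintro c rfl
      obtain ⟨c', hc, rfl⟩ := (he _ _).1 hd'
      exact .some (fun H => hu' ((hu c).trans H)) c' hc (ih c' rfl)
  · intro hv
    induction hv with
    | @all c b hu' _ ih =>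
      refine .all ((hu c).trans hu') fun d hd => ?_
      obtain ⟨c', hc, rfl⟩ := (he _ _).1 hd
      exact ih c' hc
    | @some c b hu' c' hc _ ih =>
      exact .some (fun H => hu' ((hu c).symm.trans H)) (h c') ((he _ _).2 ⟨c', hc, rfl⟩) ih

/-- With finite branching, finitely many rounds of evolution reach every value. -/
theorem evoStar_eq_some_iff_val {E : EvalGraph.{u}} (hE : ∀ c, {c' | E.Edge c c'}.Finite)
    (c : E.Node) (b : Bool) : E.evoStar c = some b ↔ E.Val c b := by
  constructor
  · rw [evoStar_eq_some]
    rintro ⟨n, hn⟩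
    induction n generalizing c b with
    | zero => simp [iter] at hn
    | succ n ih =>
      rw [iter_succ] at hn
      rcases forces_or_eq_of_evo_eq hn with h | h
      · cases b
        · rcases h with ⟨hu, c', hc, h⟩ | ⟨hu, h⟩
          · exact .some (by simp [hu]) c' hc (ih _ _ h)
          · exact .all (by simp [hu]) fun c' hc => ih _ _ (h c' hc)
        · rcases h with ⟨hu, h⟩ | ⟨hu, c', hc, h⟩
          · exact .all (by simp [hu]) fun c' hc => ih _ _ (h c' hc)
          · exact .some (by simp [hu]) c' hc (ih _ _ h)
      · exact ih _ _ h
  · intro h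
    induction h with
    | @all c b hu _ ih =>
      rw [← (E.evoStar_isLeast hE).1]
      apply Forces.evo_eq
      cases b
      · exact Or.inr ⟨by simpa using hu, ih⟩
      · exact Or.inl ⟨by simpa using hu, ih⟩
    | @some c b hu c' hc _ ih =>
      rw [← (E.evoStar_isLeast hE).1]
      apply Forces.evo_eq
      cases b
      · exact Or.inl ⟨by simpa using hu, c', hc, ih⟩
      · exact Or.inr ⟨by simpa using hu, c', hc, ih⟩

end EvalGraph

/-! ### Cutting along expressions -/

namespace Graph

theorem ext_of_att {G H : Graph Voc} (hn : G.nodes = H.nodes) (he : G.edges = H.edges)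
    (h : ∀ e (hG : e ∈ G.edges) (hH : e ∈ H.edges),
      G.att ⟨e, hG⟩ = H.att ⟨e, hH⟩ ∧ G.lab ⟨e, hG⟩ = H.lab ⟨e, hH⟩)
    (hf : G.front = H.front) (hr : G.rear = H.rear) : G = H := by
  cases G
  cases H
  dsimp only at hn he hf hr
  subst hn he hf hr
  congr 1
  · exact funext fun e => (h e.1 e.2 e.2).1
  · exact funext fun e => (h e.1 e.2 e.2).2

theorem IsFrontal.of_concat {P Q C G : Graph Voc} (hc : IsConcat P Q C) (h : IsFrontal C G) :
    IsFrontal P G where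
  nodes_sub := fun v hv => h.nodes_sub (by simp [hc.nodes_eq, hv])
  edges_sub := fun e he => h.edges_sub (by simp [hc.edges_eq, he])
  edge_eq := fun e he hG => by
    have hC : e ∈ C.edges := by simp [hc.edges_eq, he]
    rw [← (hc.left e he hC).1, ← (hc.left e he hC).2]
    exact h.edge_eq e hC hG
  front_eq := hc.front_eq ▸ h.front_eq
  rear_mem := fun v hv hr => by
    have := h.rear_mem v (by simp [hc.nodes_eq, hv]) hr
    rw [hc.rear_eq] at this
    exact (hc.inter v).1 ⟨hv, Q.rear_mem v this⟩

theorem IsFrontal.cut_of_concat {P Q C G : Graph Voc} (hc : IsConcat P Q C) (h : IsFrontal C G)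
    (hP : IsFrontal P G) : IsFrontal Q (G.cut P hP) where
  nodes_sub := fun v hv => Finset.mem_filter.2
    ⟨h.nodes_sub (by simp [hc.nodes_eq, hv]), fun hn => hn.2 ((hc.inter v).1 ⟨hn.1, hv⟩)⟩
  edges_sub := fun e he => by
    have hC : e ∈ C.edges := by simp [hc.edges_eq, he]
    refine Finset.mem_filter.2 ⟨h.edges_sub hC,
      fun heP => Finset.disjoint_left.1 hc.disj heP he, fun heG v hv hn => ?_⟩
    rw [← (h.edge_eq e hC heG).2, (hc.right e he hC).1] at hv
    exact hn.2 ((hc.inter v).1 ⟨hn.1, Q.att_mem _ v hv⟩)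
  edge_eq := fun e he hG => by
    have hC : e ∈ C.edges := by simp [hc.edges_eq, he]
    rw [← (hc.right e he hC).1, ← (hc.right e he hC).2]
    exact h.edge_eq e hC (Finset.mem_filter.1 hG).1
  front_eq := hc.interface.symm
  rear_mem := fun v hv hr => by
    rw [← hc.rear_eq]
    exact h.rear_mem v (by simp [hc.nodes_eq, hv]) hr

/-- Cutting along a concatenation is the same as cutting twice, on the nose. -/
theorem cut_concat {P Q C G : Graph Voc} (hc : IsConcat P Q C) (h : IsFrontal C G)
    (hP : IsFrontal P G) (hQ : IsFrontal Q (G.cut P hP)) :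
    G.cut C h = (G.cut P hP).cut Q hQ := by
  have key : ∀ v, (v ∈ C.nodes ∧ v ∉ C.rear) ↔
      (v ∈ P.nodes ∧ v ∉ P.rear) ∨ (v ∈ Q.nodes ∧ v ∉ Q.rear) := by
    intro v
    have h1 := hc.inter v
    have h2 := Q.rear_mem v
    rw [hc.nodes_eq, hc.rear_eq, Finset.mem_union]
    tauto
  refine ext_of_att ?_ ?_ (fun e hG hH => ⟨rfl, rfl⟩) hc.rear_eq rfl
  · ext v
    simp only [cut, Finset.mem_filter, key]
    tauto
  · ext e
    simp only [cut, Finset.mem_filter, key, hc.edges_eq, Finset.mem_union]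
    constructor
    · rintro ⟨h1, h2, h3⟩
      exact ⟨⟨h1, fun h => h2 (Or.inl h), fun he v hv hn => h3 he v hv (Or.inl hn)⟩,
        fun h => h2 (Or.inr h), fun he v hv hn => h3 he.1 v hv (Or.inr hn)⟩
    · rintro ⟨⟨h1, h2, h3⟩, h4, h5⟩
      exact ⟨h1, fun h => h.elim h2 h4, fun he v hv hn =>
        hn.elim (h3 he v hv) (h5 ⟨h1, h2, h3⟩ v hv)⟩

/-- Two successive cuts are one cut along a concatenation. -/
theorem exists_concat {P Q G : Graph Voc} (hP : IsFrontal P G) (hQ : IsFrontal Q (G.cut P hP)) :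
    ∃ C, IsConcat P Q C ∧ IsFrontal C G := by
  have hPe : ∀ e (h : e ∈ P.edges), P.att ⟨e, h⟩ = G.att ⟨e, hP.edges_sub h⟩ ∧
      P.lab ⟨e, h⟩ = G.lab ⟨e, hP.edges_sub h⟩ := fun e h =>
    (hP.edge_eq e h (hP.edges_sub h)).symm
  have hQG : ∀ e ∈ Q.edges, e ∈ G.edges := fun e h => (Finset.mem_filter.1 (hQ.edges_sub h)).1
  have hQe : ∀ e (h : e ∈ Q.edges), Q.att ⟨e, h⟩ = G.att ⟨e, hQG e h⟩ ∧
      Q.lab ⟨e, h⟩ = G.lab ⟨e, hQG e h⟩ := fun e h =>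
    (hQ.edge_eq e h (hQ.edges_sub h)).symm
  have hsub : ∀ e ∈ P.edges ∪ Q.edges, e ∈ G.edges := fun e he =>
    (Finset.mem_union.1 he).elim (fun h => hP.edges_sub h) (hQG e)
  have hinter : ∀ v, (v ∈ P.nodes ∧ v ∈ Q.nodes) ↔ v ∈ P.rear := by
    intro v
    constructor
    · rintro ⟨h1, h2⟩
      have := (Finset.mem_filter.1 (hQ.nodes_sub h2)).2
      tauto
    · intro h
      exact ⟨P.rear_mem v h, Q.front_mem v (hQ.front_eq ▸ h)⟩
  let C : Graph Voc :=
    { nodes := P.nodes ∪ Q.nodes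
      edges := P.edges ∪ Q.edges
      att := fun e => G.att ⟨e.1, hsub e.1 e.2⟩
      lab := fun e => G.lab ⟨e.1, hsub e.1 e.2⟩
      front := P.front
      rear := Q.rear
      att_mem := by
        rintro ⟨e, he⟩ v hv
        rcases Finset.mem_union.1 he with h | h
        · exact Finset.mem_union_left _ (P.att_mem ⟨e, h⟩ v ((hPe e h).1 ▸ hv))
        · exact Finset.mem_union_right _ (Q.att_mem ⟨e, h⟩ v ((hQe e h).1 ▸ hv))
      att_length := fun _ => G.att_length _
      front_mem := fun v hv => Finset.mem_union_left _ (P.front_mem v hv)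
      rear_mem := fun v hv => Finset.mem_union_right _ (Q.rear_mem v hv)
      front_nodup := P.front_nodup
      rear_nodup := Q.rear_nodup }
  refine ⟨C, ?_, ?_⟩
  · exact
      { interface := hQ.front_eq.symm
        inter := hinter
        disj := Finset.disjoint_left.2 fun e h1 h2 =>
          (Finset.mem_filter.1 (hQ.edges_sub h2)).2.1 h1
        nodes_eq := rfl
        edges_eq := rfl
        left := fun e h _ => ⟨(hPe e h).1.symm, (hPe e h).2.symm⟩
        right := fun e h _ => ⟨(hQe e h).1.symm, (hQe e h).2.symm⟩
        front_eq := rfl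
        rear_eq := rfl }
  · exact
      { nodes_sub := Finset.union_subset hP.nodes_sub
          fun v hv => (Finset.mem_filter.1 (hQ.nodes_sub hv)).1
        edges_sub := hsub
        edge_eq := fun _ _ _ => ⟨rfl, rfl⟩
        front_eq := hP.front_eq
        rear_mem := fun v hv hr => by
          refine hQ.rear_mem v ?_ hr
          rcases Finset.mem_union.1 hv with h | h
          · exact ((hinter v).2 (hP.rear_mem v h hr)).2
          · exact h }

/-- The graph without edges that has the given interfaces and whose nodes are the rear nodes. -/
def discrete {l r : List ℕ} (hl : l.Nodup) (hr : r.Nodup) (h : ∀ v ∈ l, v ∈ r) : Graph Voc where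
  nodes := r.toFinset
  edges := ∅
  att := fun e => absurd e.2 (Finset.notMem_empty _)
  lab := fun e => absurd e.2 (Finset.notMem_empty _)
  front := l
  rear := r
  att_mem := fun e => absurd e.2 (Finset.notMem_empty _)
  att_length := fun e => absurd e.2 (Finset.notMem_empty _)
  front_mem := fun v hv => List.mem_toFinset.2 (h v hv)
  rear_mem := fun _ hv => List.mem_toFinset.2 hv
  front_nodup := hl
  rear_nodup := hr

theorem discrete_isFrontal {l r : List ℕ} {hl : l.Nodup} {hr : r.Nodup} {h : ∀ v ∈ l, v ∈ r}
    {G : Graph Voc} (hf : l = G.front) (hn : ∀ v ∈ r, v ∈ G.nodes) :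
    IsFrontal (discrete hl hr h) G where
  nodes_sub := fun v hv => hn v (List.mem_toFinset.1 hv)
  edges_sub := Finset.empty_subset _
  edge_eq := fun _ h => absurd h (Finset.notMem_empty _)
  front_eq := hf
  rear_mem := fun _ hv _ => List.mem_toFinset.1 hv

/-- Cutting changes only the front interface if the subgraph has no edges and all its nodes are
rear nodes. -/
theorem cut_eq_of_inert {P G G' : Graph Voc} (h : IsFrontal P G) (he : P.edges = ∅)
    (hr : ∀ v ∈ P.nodes, v ∈ P.rear) (hn : G'.nodes = G.nodes) (hE : G'.edges = G.edges)
    (hatt : ∀ e (h : e ∈ G.edges) (h' : e ∈ G'.edges),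
      G.att ⟨e, h⟩ = G'.att ⟨e, h'⟩ ∧ G.lab ⟨e, h⟩ = G'.lab ⟨e, h'⟩)
    (hf : G'.front = P.rear) (hrear : G'.rear = G.rear) : G.cut P h = G' := by
  refine ext_of_att ?_ ?_ (fun e hG hH => hatt e (Finset.mem_filter.1 hG).1 hH) hf.symm hrear.symm
  · rw [hn]
    exact Finset.filter_true_of_mem fun v _ hv => hv.2 (hr v hv.1)
  · rw [hE]
    exact Finset.filter_true_of_mem fun e _ => ⟨by simp [he], fun _ v _ hv => hv.2 (hr v hv.1)⟩

theorem cut_identity {P G : Graph Voc} (h : IsFrontal P G) (hP : P.IsIdentity) : G.cut P h = G :=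
  cut_eq_of_inert h hP.1 (fun v hv => hP.2.1 ▸ hP.2.2 v hv) rfl rfl (fun _ _ _ => ⟨rfl, rfl⟩)
    (by rw [← hP.2.1, h.front_eq]) rfl

end Graph

/-- `G'` arises from `G` by cutting off a frontal subgraph in the language `L`. -/
def LangCuts {i j : ℕ} (L : Set (TGraph Voc i j)) (G : FGraph Voc i) (G' : FGraph Voc j) : Prop :=
  ∃ (P : TGraph Voc i j) (h : P.1.IsFrontal G.1), P ∈ L ∧ G' = ⟨G.1.cut P.1 h, P.2.2⟩

theorem langCuts_concat {i j k : ℕ} {L : Set (TGraph Voc i j)} {M : Set (TGraph Voc j k)}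
    {G : FGraph Voc i} {G' : FGraph Voc k} :
    LangCuts (langConcat L M) G G' ↔ ∃ H, LangCuts L G H ∧ LangCuts M H G' := by
  constructor
  · rintro ⟨C, hC, ⟨P, hP, Q, hQ, hc⟩, rfl⟩
    have h1 := hC.of_concat hc
    have h2 := hC.cut_of_concat hc h1
    exact ⟨_, ⟨P, h1, hP, rfl⟩, Q, h2, hQ, Subtype.ext (Graph.cut_concat hc hC h1 h2)⟩
  · rintro ⟨_, ⟨P, h1, hP, rfl⟩, Q, h2, hQ, rfl⟩
    obtain ⟨C, hc, hC⟩ := Graph.exists_concat h1 h2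
    exact ⟨⟨C, by rw [hc.front_eq, P.2.1], by rw [hc.rear_eq, Q.2.2]⟩, hC, ⟨P, hP, Q, hQ, hc⟩,
      Subtype.ext (Graph.cut_concat hc hC h1 h2).symm⟩

theorem langCuts_star {i : ℕ} {L : Set (TGraph Voc i i)} {G G' : FGraph Voc i} :
    LangCuts {P | LangStar L P} G G' ↔ Relation.ReflTransGen (LangCuts L) G G' := by
  constructor
  · rintro ⟨P, h, hP, rfl⟩
    change LangStar L P at hP
    induction hP generalizing G with
    | one P hP =>
      rw [show (⟨G.1.cut P.1 h, P.2.2⟩ : FGraph Voc i) = G from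
        Subtype.ext (Graph.cut_identity h hP)]
    | cons P Q C hP _ hc ih =>
      have h1 := h.of_concat hc
      have h2 := h.cut_of_concat hc h1
      rw [show (⟨G.1.cut C.1 h, C.2.2⟩ : FGraph Voc i) = ⟨(G.1.cut P.1 h1).cut Q.1 h2, Q.2.2⟩ from
        Subtype.ext (Graph.cut_concat hc h h1 h2)]
      exact .head ⟨P, h1, hP, rfl⟩ (ih (G := ⟨G.1.cut P.1 h1, P.2.2⟩) h2)
  · intro h
    induction h using Relation.ReflTransGen.head_induction_on with
    | refl =>
      let P := Graph.discrete (Voc := Voc) G'.1.front_nodup G'.1.front_nodup fun _ h => h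
      have hid : P.IsIdentity := ⟨rfl, rfl, fun v hv => List.mem_toFinset.1 hv⟩
      have hP : P.IsFrontal G'.1 := Graph.discrete_isFrontal rfl G'.1.front_mem
      exact ⟨⟨P, G'.2, G'.2⟩, hP, .one _ hid, Subtype.ext (Graph.cut_identity hP hid).symm⟩
    | head h _ ih =>
      have := (langCuts_concat (L := L) (M := {P | LangStar L P})).2 ⟨_, h, ih⟩
      obtain ⟨C, hC, ⟨P, hP, Q, hQ, hc⟩, rfl⟩ := this
      exact ⟨C, hC, .cons P Q C hP hQ hc, rfl⟩

namespace GExpr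

/-- `G'` arises from `G` by cutting off a frontal subgraph in the language of `e`. -/
def Cuts {i j : ℕ} (e : GExpr Voc i j) : FGraph Voc i → FGraph Voc j → Prop := LangCuts e.lang

variable {i j k : ℕ}

theorem not_cuts_empty {G : FGraph Voc i} {G' : FGraph Voc j} :
    ¬ (empty : GExpr Voc i j).Cuts G G' := by
  rintro ⟨P, _, hP, _⟩
  simp [lang] at hP

theorem cuts_union {e₁ e₂ : GExpr Voc i j} {G : FGraph Voc i} {G' : FGraph Voc j} :
    (e₁.union e₂).Cuts G G' ↔ e₁.Cuts G G' ∨ e₂.Cuts G G' := by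
  simp only [Cuts, LangCuts, lang, Set.mem_union]
  constructor
  · rintro ⟨P, h, hP | hP, rfl⟩
    exacts [Or.inl ⟨P, h, hP, rfl⟩, Or.inr ⟨P, h, hP, rfl⟩]
  · rintro (⟨P, h, hP, rfl⟩ | ⟨P, h, hP, rfl⟩)
    exacts [⟨P, h, Or.inl hP, rfl⟩, ⟨P, h, Or.inr hP, rfl⟩]

theorem cuts_concat {e₁ : GExpr Voc i j} {e₂ : GExpr Voc j k} {G : FGraph Voc i}
    {G' : FGraph Voc k} : (e₁.concat e₂).Cuts G G' ↔ ∃ H, e₁.Cuts G H ∧ e₂.Cuts H G' := by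
  simp only [Cuts, lang, langCuts_concat]

theorem cuts_star {e : GExpr Voc i i} {G G' : FGraph Voc i} :
    e.star.Cuts G G' ↔ Relation.ReflTransGen e.Cuts G G' := by
  simp only [Cuts, lang, langCuts_star]

end GExpr

/-! ### Cuts that remove nothing -/

namespace Graph

/-- The number of nodes and edges. -/
def size (G : Graph Voc) : ℕ := G.nodes.card + G.edges.card

/-- Graphs without edges whose nodes are all rear nodes: cutting them off removes nothing. -/
def IsInert (P : Graph Voc) : Prop := P.edges = ∅ ∧ ∀ v ∈ P.nodes, v ∈ P.rear

theorem size_cut_le {P G : Graph Voc} (h : IsFrontal P G) : (G.cut P h).size ≤ G.size :=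
  Nat.add_le_add (Finset.card_filter_le _ _) (Finset.card_filter_le _ _)

theorem isInert_of_size_cut_eq {P G : Graph Voc} (h : IsFrontal P G)
    (hs : (G.cut P h).size = G.size) : P.IsInert := by
  have hn : (G.cut P h).nodes.card ≤ G.nodes.card := Finset.card_filter_le _ _
  have he : (G.cut P h).edges.card ≤ G.edges.card := Finset.card_filter_le _ _
  unfold size at hs
  have hn' : (G.cut P h).nodes = G.nodes :=
    Finset.eq_of_subset_of_card_le (Finset.filter_subset _ _) (by omega)
  have he' : (G.cut P h).edges = G.edges :=
    Finset.eq_of_subset_of_card_le (Finset.filter_subset _ _) (by omega)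
  constructor
  · refine Finset.eq_empty_of_forall_notMem fun e hP => ?_
    have := h.edges_sub hP
    rw [← he'] at this
    exact (Finset.mem_filter.1 this).2.1 hP
  · intro v hv
    have := h.nodes_sub hv
    rw [← hn'] at this
    have := (Finset.mem_filter.1 this).2
    tauto

theorem IsInert.size_cut {P G : Graph Voc} (hP : P.IsInert) (h : IsFrontal P G) :
    (G.cut P h).size = G.size := by
  have h1 : (G.cut P h).nodes = G.nodes :=
    Finset.filter_true_of_mem fun v _ hv => hv.2 (hP.2 v hv.1)
  have h2 : (G.cut P h).edges = G.edges := Finset.filter_true_of_mem fun e _ =>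
    ⟨by simp [hP.1], fun _ v _ hv => hv.2 (hP.2 v hv.1)⟩
  rw [size, h1, h2, size]

theorem Iso.isInert_iff {G H : Graph Voc} (h : Iso G H) : G.IsInert ↔ H.IsInert := by
  obtain ⟨φ, ψ, hb, -, -, hr⟩ := h
  refine and_congr ⟨fun h => ?_, fun h => ?_⟩ ⟨fun h v hv => ?_, fun h v hv => ?_⟩
  · exact Finset.eq_empty_of_forall_notMem fun e he =>
      absurd (ψ.symm ⟨e, he⟩).2 (by simp [h])
  · exact Finset.eq_empty_of_forall_notMem fun e he => absurd (ψ ⟨e, he⟩).2 (by simp [h])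
  · obtain ⟨w, hw, rfl⟩ := hb.surjOn hv
    exact hr ▸ List.mem_map_of_mem (h w hw)
  · have := h _ (hb.mapsTo hv)
    rw [hr, List.mem_map] at this
    obtain ⟨w, hw, hwv⟩ := this
    exact hb.injOn (G.rear_mem w hw) hv hwv ▸ hw

theorem Iso.trans {G H K : Graph Voc} : Iso G H → Iso H K → Iso G K := by
  rintro ⟨φ, ψ, hb, he, hf, hr⟩ ⟨φ', ψ', hb', he', hf', hr'⟩
  refine ⟨φ' ∘ φ, ψ.trans ψ', hb'.comp hb, fun e => ?_, ?_, ?_⟩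
  · exact ⟨((he' _).1).trans (he e).1, by simp [(he' _).2, (he e).2]⟩
  · simp [hf', hf]
  · simp [hr', hr]

/-- `P` is inert, and the `a`-th front node is the `p a`-th rear
node. The pattern determines an inert graph up to isomorphism. -/
structure HasPattern {i j : ℕ} (P : Graph Voc) (p : Fin i ↪ Fin j) : Prop where
  isInert : P.IsInert
  front_eq : ∀ a : Fin i, P.front[(a : ℕ)]? = P.rear[(p a : ℕ)]?

theorem HasPattern.of_iso {i j : ℕ} {P Q : Graph Voc} {p : Fin i ↪ Fin j} (h : Iso P Q)
    (hP : P.HasPattern p) : Q.HasPattern p := by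
  obtain ⟨he, hn⟩ := h.isInert_iff.1 hP.isInert
  obtain ⟨φ, -, -, -, hf, hr⟩ := h
  refine ⟨⟨he, hn⟩, fun a => ?_⟩
  rw [hf, hr, List.getElem?_map, List.getElem?_map, hP.front_eq]

theorem HasPattern.iso {i j : ℕ} {P Q : TGraph Voc i j} {p : Fin i ↪ Fin j}
    (hP : P.1.HasPattern p) (hQ : Q.1.HasPattern p) : Iso P.1 Q.1 := by
  classical
  have hlP := P.2.2
  have hlQ := Q.2.2
  -- the isomorphism sends the `k`-th rear node of `P` to the `k`-th rear node of `Q`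
  let φ : ℕ → ℕ := fun v => Q.1.rear.getD (P.1.rear.idxOf v) 0
  have hφ : ∀ k (h : k < P.1.rear.length), φ P.1.rear[k] = Q.1.rear[k]'(by omega) := by
    intro k h
    simp only [φ]
    rw [P.1.rear_nodup.idxOf_getElem k h, List.getD_eq_getElem]
  have hr : Q.1.rear = P.1.rear.map φ := by
    refine List.ext_getElem (by simp [hlP, hlQ]) fun k h1 h2 => ?_
    rw [List.getElem_map, hφ]
  have hempty : ∀ e : {e // e ∈ P.1.edges}, False := fun e => by simpa [hP.isInert.1] using e.2
  have hempty' : ∀ e : {e // e ∈ Q.1.edges}, False := fun e => by simpa [hQ.isInert.1] using e.2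
  refine ⟨φ, ⟨fun e => (hempty e).elim, fun e => (hempty' e).elim, fun e => (hempty e).elim,
    fun e => (hempty' e).elim⟩, ⟨?_, ?_, ?_⟩, fun e => (hempty e).elim, ?_, hr⟩
  · intro v hv
    refine Q.1.rear_mem _ ?_
    rw [hr]
    exact List.mem_map_of_mem (hP.isInert.2 v hv)
  · intro v hv w hw hvw
    obtain ⟨k, hk, rfl⟩ := List.getElem_of_mem (hP.isInert.2 v hv)
    obtain ⟨l, hl, rfl⟩ := List.getElem_of_mem (hP.isInert.2 w hw)
    rw [hφ, hφ, Q.1.rear_nodup.getElem_inj_iff] at hvw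
    subst hvw
    rfl
  · intro v hv
    have := hQ.isInert.2 v hv
    rw [hr, List.mem_map] at this
    obtain ⟨w, hw, rfl⟩ := this
    exact ⟨w, P.1.rear_mem w hw, rfl⟩
  · refine List.ext_getElem? fun a => ?_
    by_cases ha : a < i
    · have h1 := hP.front_eq ⟨a, ha⟩
      have h2 := hQ.front_eq ⟨a, ha⟩
      dsimp only at h1 h2
      rw [h2, List.getElem?_map, h1, hr, List.getElem?_map]
    · have h1 := P.2.1
      have h2 := Q.2.1
      rw [List.getElem?_eq_none (by omega), List.getElem?_eq_none (by simp; omega)]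

end Graph

theorem getElem?_selected {i j : ℕ} {l : List ℕ} (hl : l.length = j) (p : Fin i ↪ Fin j)
    (a : Fin i) :
    (List.ofFn fun a => l.get ((p a).cast hl.symm))[(a : ℕ)]? = l[(p a : ℕ)]? := by
  subst hl
  simp

theorem nodup_selected {i j : ℕ} {l : List ℕ} (hl : l.length = j) (hn : l.Nodup)
    (p : Fin i ↪ Fin j) : (List.ofFn fun a => l.get ((p a).cast hl.symm)).Nodup := by
  subst hl
  exact List.nodup_ofFn.2 ((List.nodup_iff_injective_get.1 hn).comp p.injective)

theorem selected_subset {i j : ℕ} {l : List ℕ} (hl : l.length = j) (p : Fin i ↪ Fin j) :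
    ∀ v ∈ (List.ofFn fun a => l.get ((p a).cast hl.symm)), v ∈ l := by
  intro v hv
  obtain ⟨a, rfl⟩ := (List.mem_ofFn' _ _).1 hv
  exact List.get_mem _ _

/-- The graph `G` with its front interface replaced by the selection `p` of front nodes. -/
def pull {i j : ℕ} (p : Fin i ↪ Fin j) (G : FGraph Voc j) : FGraph Voc i :=
  ⟨{ nodes := G.1.nodes
     edges := G.1.edges
     att := G.1.att
     lab := G.1.lab
     front := List.ofFn fun a => G.1.front.get ((p a).cast G.2.symm)
     rear := G.1.rear
     att_mem := G.1.att_mem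
     att_length := G.1.att_length
     front_mem := fun v hv => G.1.front_mem v (selected_subset G.2 p v hv)
     rear_mem := G.1.rear_mem
     front_nodup := nodup_selected G.2 G.1.front_nodup p
     rear_nodup := G.1.rear_nodup }, List.length_ofFn⟩

theorem eq_pull {i j : ℕ} {p : Fin i ↪ Fin j} {H : FGraph Voc i} {G : FGraph Voc j}
    (hn : H.1.nodes = G.1.nodes) (he : H.1.edges = G.1.edges)
    (h : ∀ e (hH : e ∈ H.1.edges) (hG : e ∈ G.1.edges),
      H.1.att ⟨e, hH⟩ = G.1.att ⟨e, hG⟩ ∧ H.1.lab ⟨e, hH⟩ = G.1.lab ⟨e, hG⟩)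
    (hf : ∀ a : Fin i, H.1.front[(a : ℕ)]? = G.1.front[(p a : ℕ)]?)
    (hr : H.1.rear = G.1.rear) : H = pull p G := by
  refine Subtype.ext (Graph.ext_of_att hn he h (List.ext_getElem? fun a => ?_) hr)
  by_cases ha : a < i
  · exact (hf ⟨a, ha⟩).trans (getElem?_selected G.2 p ⟨a, ha⟩).symm
  · have h1 := H.2
    rw [List.getElem?_eq_none (by omega), List.getElem?_eq_none (by simp [pull]; omega)]

theorem pull_refl {i : ℕ} (G : FGraph Voc i) : pull (.refl _) G = G :=
  (eq_pull rfl rfl (fun _ _ _ => ⟨rfl, rfl⟩) (fun _ => rfl) rfl).symm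

theorem pull_pull {i j k : ℕ} (p : Fin i ↪ Fin j) (q : Fin j ↪ Fin k) (G : FGraph Voc k) :
    pull p (pull q G) = pull (p.trans q) G :=
  eq_pull rfl rfl (fun _ _ _ => ⟨rfl, rfl⟩)
    (fun a => (getElem?_selected (pull q G).2 p a).trans (getElem?_selected G.2 q (p a))) rfl

theorem size_pull {i j : ℕ} (p : Fin i ↪ Fin j) (G : FGraph Voc j) :
    (pull p G).1.size = G.1.size := rfl

/-- The edgeless graph with pattern `p` that has the rear interface `l`. -/
def patternGraph {i j : ℕ} (p : Fin i ↪ Fin j) {l : List ℕ} (hl : l.length = j) (hn : l.Nodup) :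
    TGraph Voc i j :=
  ⟨.discrete (nodup_selected hl hn p) hn (selected_subset hl p), List.length_ofFn, hl⟩

theorem patternGraph_hasPattern {i j : ℕ} (p : Fin i ↪ Fin j) {l : List ℕ} (hl : l.length = j)
    (hn : l.Nodup) : (patternGraph p hl hn : TGraph Voc i j).1.HasPattern p :=
  ⟨⟨rfl, fun _ hv => List.mem_toFinset.1 hv⟩, getElem?_selected hl p⟩

theorem Graph.HasPattern.eq_pull {i j : ℕ} {p : Fin i ↪ Fin j} {P : TGraph Voc i j}
    (hP : P.1.HasPattern p) {G : FGraph Voc i} (h : P.1.IsFrontal G.1) :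
    G = pull p ⟨G.1.cut P.1 h, P.2.2⟩ := by
  have h1 : (G.1.cut P.1 h).nodes = G.1.nodes :=
    Finset.filter_true_of_mem fun v _ hv => hv.2 (hP.isInert.2 v hv.1)
  have h2 : (G.1.cut P.1 h).edges = G.1.edges := Finset.filter_true_of_mem fun e _ =>
    ⟨by simp [hP.isInert.1], fun _ v _ hv => hv.2 (hP.isInert.2 v hv.1)⟩
  refine GraphFormula.eq_pull h1.symm h2.symm (fun _ _ _ => ⟨rfl, rfl⟩) (fun a => ?_) rfl
  rw [← h.front_eq]
  exact hP.front_eq a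

/-- A selection of front nodes is undone by cutting off an inert graph with this pattern. -/
theorem exists_cut_pull {i j : ℕ} (p : Fin i ↪ Fin j) (G : FGraph Voc j) :
    ∃ (P : TGraph Voc i j) (h : P.1.IsFrontal (pull p G).1), P.1.HasPattern p ∧
      G = ⟨(pull p G).1.cut P.1 h, P.2.2⟩ := by
  have hP := patternGraph_hasPattern (Voc := Voc) p G.2 G.1.front_nodup
  have h : (patternGraph p G.2 G.1.front_nodup).1.IsFrontal (pull p G).1 :=
    Graph.discrete_isFrontal (h := selected_subset G.2 p) rfl G.1.front_mem
  exact ⟨_, h, hP, Subtype.ext (Graph.cut_eq_of_inert (G' := G.1) h hP.isInert.1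
    hP.isInert.2 rfl rfl (fun _ _ _ => ⟨rfl, rfl⟩) rfl rfl).symm⟩

namespace GExpr

variable {i j k : ℕ}

theorem cuts_patternGraph {p : Fin i ↪ Fin j} {l : List ℕ} {hl : l.length = j} {hn : l.Nodup}
    {G : FGraph Voc i} {G' : FGraph Voc j} :
    (graph (patternGraph p hl hn)).Cuts G G' ↔ G = pull p G' := by
  have hp := patternGraph_hasPattern (Voc := Voc) p hl hn
  constructor
  · rintro ⟨P, h, hP, rfl⟩
    simp only [lang, Set.mem_ofPred_eq] at hP
    exact (hp.of_iso hP).eq_pull h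
  · rintro rfl
    obtain ⟨P, h, hP, hG⟩ := exists_cut_pull p G'
    exact ⟨P, h, by simpa only [lang, Set.mem_ofPred_eq] using hp.iso hP, hG⟩

theorem Cuts.size_le {e : GExpr Voc i j} {G : FGraph Voc i} {G' : FGraph Voc j}
    (h : e.Cuts G G') : G'.1.size ≤ G.1.size := by
  obtain ⟨P, h, -, rfl⟩ := h
  exact Graph.size_cut_le h

/-- The language of an expression contains either all or none of the graphs with a given pattern,
hence a cut along it that removes nothing is possible wherever its pattern fits. -/
theorem Cuts.exists_pattern {e : GExpr Voc i j} {G : FGraph Voc i} {G' : FGraph Voc j}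
    (h : e.Cuts G G') (hs : G'.1.size = G.1.size) :
    ∃ p : Fin i ↪ Fin j, G = pull p G' ∧ ∀ H, e.Cuts (pull p H) H := by
  induction e with
  | empty => exact absurd h not_cuts_empty
  | @graph i j K =>
    obtain ⟨P, hf, hP, rfl⟩ := h
    simp only [lang, Set.mem_ofPred_eq] at hP
    have hin := Graph.isInert_of_size_cut_eq hf hs
    have hex : ∀ a : Fin i, ∃ b : Fin j, P.1.front[(a : ℕ)]? = P.1.rear[(b : ℕ)]? := by
      intro a
      have ha : (a : ℕ) < P.1.front.length := a.2.trans_eq P.2.1.symm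
      obtain ⟨b, hb, hab⟩ := List.getElem_of_mem
        (hin.2 _ (P.1.front_mem _ (List.getElem_mem ha)))
      exact ⟨⟨b, hb.trans_eq P.2.2⟩, by simp [hb, ha, hab]⟩
    choose f hf' using hex
    have hinj : Function.Injective f := by
      intro a b hab
      have h1 : P.1.front[(a : ℕ)]? = P.1.front[(b : ℕ)]? := by rw [hf', hf', hab]
      exact Fin.ext ((List.getElem?_inj (by rw [P.2.1]; exact a.2) P.1.front_nodup).1 h1)
    have hp : P.1.HasPattern (⟨f, hinj⟩ : Fin i ↪ Fin j) := ⟨hin, hf'⟩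
    refine ⟨⟨f, hinj⟩, hp.eq_pull hf, fun H => ?_⟩
    obtain ⟨Q, h, hQ, hH⟩ := exists_cut_pull ⟨f, hinj⟩ H
    exact ⟨Q, h, by simpa only [lang, Set.mem_ofPred_eq] using hP.trans (hp.iso hQ), hH⟩
  | union e₁ e₂ ih₁ ih₂ =>
    rcases cuts_union.1 h with h | h
    · obtain ⟨p, hp, hH⟩ := ih₁ h hs
      exact ⟨p, hp, fun H => cuts_union.2 (Or.inl (hH H))⟩
    · obtain ⟨p, hp, hH⟩ := ih₂ h hs
      exact ⟨p, hp, fun H => cuts_union.2 (Or.inr (hH H))⟩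
  | concat e₁ e₂ ih₁ ih₂ =>
    obtain ⟨K, h1, h2⟩ := cuts_concat.1 h
    have := h1.size_le
    have := h2.size_le
    obtain ⟨p, rfl, hp⟩ := ih₁ h1 (by omega)
    obtain ⟨q, rfl, hq⟩ := ih₂ h2 (by omega)
    exact ⟨p.trans q, pull_pull _ _ _, fun H => cuts_concat.2
      ⟨pull q H, by rw [← pull_pull]; exact hp _, hq H⟩⟩
  | star e ih =>
    rw [cuts_star] at h
    induction h using Relation.ReflTransGen.head_induction_on with
    | refl => exact ⟨.refl _, (pull_refl _).symm, fun H => by rw [pull_refl, cuts_star]⟩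
    | head h1 h2 ih' =>
      have := h1.size_le
      have := (cuts_star.2 h2).size_le
      obtain ⟨p, rfl, hp⟩ := ih h1 (by omega)
      obtain ⟨q, rfl, hq⟩ := ih' (by omega)
      exact ⟨p.trans q, pull_pull _ _ _, fun H => cuts_star.2
        (.head (by rw [← pull_pull]; exact hp _) (cuts_star.1 (hq H)))⟩

/-! ### Expressions whose iterations consume the graph -/

/-- Every iterated subexpression removes some node or edge in each cut. -/
def Consuming : {i j : ℕ} → GExpr Voc i j → Prop
  | _, _, .empty => True
  | _, _, .graph _ => True
  | _, _, .union e₁ e₂ => e₁.Consuming ∧ e₂.Consuming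
  | _, _, .concat e₁ e₂ => e₁.Consuming ∧ e₂.Consuming
  | _, _, .star e => e.Consuming ∧ ∀ G G', e.Cuts G G' → G'.1.size < G.1.size

/-- The union of a list of expressions. -/
def listUnion : List (GExpr Voc i j) → GExpr Voc i j
  | [] => .empty
  | e :: l => .union e (listUnion l)

theorem cuts_listUnion {l : List (GExpr Voc i j)} {G : FGraph Voc i} {G' : FGraph Voc j} :
    (listUnion l).Cuts G G' ↔ ∃ e ∈ l, e.Cuts G G' := by
  induction l with
  | nil => simp [listUnion, not_cuts_empty]
  | cons e l ih => simp [listUnion, cuts_union, ih]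

theorem consuming_listUnion {l : List (GExpr Voc i j)} (h : ∀ e ∈ l, e.Consuming) :
    (listUnion l).Consuming := by
  induction l with
  | nil => simp [listUnion, Consuming]
  | cons e l ih => simp_all [listUnion, Consuming]

open Classical in
/-- The part of `e` that removes nothing, as a union of single graphs, one for each pattern. -/
noncomputable def inert (e : GExpr Voc i j) : GExpr Voc i j :=
  listUnion (((Finset.univ : Finset (Fin i ↪ Fin j)).filter
    fun p => ∀ H, e.Cuts (pull p H) H).toList.map
      fun p => .graph (patternGraph p List.length_range List.nodup_range))

theorem cuts_inert {e : GExpr Voc i j} {G : FGraph Voc i} {G' : FGraph Voc j} :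
    e.inert.Cuts G G' ↔ e.Cuts G G' ∧ G'.1.size = G.1.size := by
  simp only [inert, cuts_listUnion, List.mem_map, Finset.mem_toList, Finset.mem_filter,
    Finset.mem_univ, true_and]
  constructor
  · rintro ⟨_, ⟨p, hp, rfl⟩, h⟩
    rw [cuts_patternGraph] at h
    subst h
    exact ⟨hp _, (size_pull _ _).symm⟩
  · rintro ⟨h, hs⟩
    obtain ⟨p, rfl, hp⟩ := h.exists_pattern hs
    exact ⟨_, ⟨p, hp, rfl⟩, cuts_patternGraph.2 rfl⟩

theorem consuming_inert (e : GExpr Voc i j) : e.inert.Consuming := by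
  refine consuming_listUnion fun e he => ?_
  obtain ⟨p, -, rfl⟩ := List.mem_map.1 he
  trivial

open Classical in
/-- The part of `e` that removes some node or edge, with all iterations made consuming. Between two
consecutive consuming factors of an iteration, `e.star.inert` stands for an arbitrary number of
inert ones. -/
noncomputable def proper : {i j : ℕ} → GExpr Voc i j → GExpr Voc i j
  | _, _, .empty => .empty
  | _, _, .graph G =>
    if G.1.IsInert then .empty else .graph G
  | _, _, .union e₁ e₂ => .union e₁.proper e₂.proper
  | _, _, .concat e₁ e₂ =>
    .union (.concat e₁.proper (.union e₂.inert e₂.proper)) (.concat e₁.inert e₂.proper)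
  | _, _, .star e =>
    .concat (.concat e.star.inert e.proper)
      (.concat (.star (.concat e.star.inert e.proper)) e.star.inert)

theorem cuts_inert_or {e f : GExpr Voc i j}
    (hf : ∀ G G', f.Cuts G G' ↔ e.Cuts G G' ∧ G'.1.size < G.1.size) {G : FGraph Voc i}
    {G' : FGraph Voc j} : e.Cuts G G' ↔ e.inert.Cuts G G' ∨ f.Cuts G G' := by
  rw [hf, cuts_inert, ← and_or_left]
  exact ⟨fun h => ⟨h, h.size_le.eq_or_lt⟩, fun h => h.1⟩

/-- In an iteration of `e`, maximal runs of inert steps can be collected into single inert steps of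
`e.star`; `f` is any expression for the steps of `e` that remove something. -/
theorem reflTransGen_of_inert {e f : GExpr Voc i i}
    (hf : ∀ G G', f.Cuts G G' ↔ e.Cuts G G' ∧ G'.1.size < G.1.size) {G G' : FGraph Voc i}
    (h : Relation.ReflTransGen e.Cuts G G') :
    ∃ H, Relation.ReflTransGen (e.star.inert.concat f).Cuts G H ∧ e.star.inert.Cuts H G' := by
  have hrefl : ∀ G, e.star.inert.Cuts G G := fun G => cuts_inert.2 ⟨cuts_star.2 .refl, rfl⟩
  induction h using Relation.ReflTransGen.head_induction_on with
  | refl => exact ⟨_, .refl, hrefl _⟩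
  | head h1 h2 ih =>
    obtain ⟨H, hW, hS⟩ := ih
    rcases (cuts_inert_or hf).1 h1 with h1' | h1'
    · -- an inert step is absorbed by the inert part that follows it
      have habs : ∀ K, e.star.inert.Cuts _ K → e.star.inert.Cuts _ K := fun K hK => by
        have hK' := cuts_inert.1 hK
        exact cuts_inert.2 ⟨cuts_star.2 (.head h1 (cuts_star.1 hK'.1)),
          hK'.2.trans (cuts_inert.1 h1').2⟩
      rcases hW.cases_head with rfl | ⟨K, hK, hW'⟩
      · exact ⟨_, .refl, habs _ hS⟩
      · obtain ⟨K', h3, h4⟩ := cuts_concat.1 hK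
        exact ⟨H, .head (cuts_concat.2 ⟨K', habs _ h3, h4⟩) hW', hS⟩
    · exact ⟨H, .head (cuts_concat.2 ⟨_, hrefl _, h1'⟩) hW, hS⟩

theorem cuts_proper {e : GExpr Voc i j} {G : FGraph Voc i} {G' : FGraph Voc j} :
    e.proper.Cuts G G' ↔ e.Cuts G G' ∧ G'.1.size < G.1.size := by
  induction e with
  | empty => simp [proper, not_cuts_empty]
  | graph K =>
    have hi : ∀ {P : TGraph Voc _ _}, P ∈ (graph K).lang → (K.1.IsInert ↔ P.1.IsInert) :=
      fun hP => by
        simp only [lang, Set.mem_ofPred_eq] at hP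
        exact hP.isInert_iff
    rw [proper]
    split_ifs with hK
    · refine iff_of_false not_cuts_empty ?_
      rintro ⟨⟨P, h, hP, rfl⟩, hs⟩
      exact hs.ne (((hi hP).1 hK).size_cut h)
    · refine ⟨fun hc => ⟨hc, hc.size_le.lt_of_ne ?_⟩, fun h => h.1⟩
      obtain ⟨P, h, hP, rfl⟩ := hc
      exact fun hs => hK ((hi hP).2 (Graph.isInert_of_size_cut_eq h hs))
  | union e₁ e₂ ih₁ ih₂ => rw [proper, cuts_union, cuts_union, ih₁, ih₂, ← or_and_right]
  | concat e₁ e₂ ih₁ ih₂ =>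
    simp only [proper, cuts_union, cuts_concat, ih₁, ih₂, cuts_inert]
    constructor
    · rintro (⟨H, ⟨h1, hs1⟩, ⟨h2, hs2⟩ | ⟨h2, hs2⟩⟩ | ⟨H, ⟨h1, hs1⟩, h2, hs2⟩) <;>
        exact ⟨⟨H, h1, h2⟩, by omega⟩
    · rintro ⟨⟨H, h1, h2⟩, hs⟩
      rcases h1.size_le.lt_or_eq with hs1 | hs1
      · rcases h2.size_le.lt_or_eq with hs2 | hs2
        · exact Or.inl ⟨H, ⟨h1, hs1⟩, Or.inr ⟨h2, hs2⟩⟩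
        · exact Or.inl ⟨H, ⟨h1, hs1⟩, Or.inl ⟨h2, hs2⟩⟩
      · exact Or.inr ⟨H, ⟨h1, hs1⟩, h2, by omega⟩
  | star e ih =>
    have hW : ∀ {G G'}, (e.star.inert.concat e.proper).Cuts G G' →
        e.star.Cuts G G' ∧ G'.1.size < G.1.size := by
      intro G G' h
      obtain ⟨H, h1, h2⟩ := cuts_concat.1 h
      rw [cuts_inert, cuts_star] at h1
      rw [ih] at h2
      exact ⟨cuts_star.2 (h1.1.tail h2.1), by omega⟩
    have hWs : ∀ {G G'}, Relation.ReflTransGen (e.star.inert.concat e.proper).Cuts G G' →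
        Relation.ReflTransGen e.Cuts G G' ∧ G'.1.size ≤ G.1.size := by
      intro G G' h
      induction h with
      | refl => exact ⟨.refl, le_rfl⟩
      | tail _ h ih' =>
        have := hW h
        exact ⟨ih'.1.trans (cuts_star.1 this.1), by omega⟩
    rw [proper, cuts_concat]
    simp only [cuts_concat (e₁ := (star _)), cuts_star (e := concat _ _)]
    constructor
    · rintro ⟨H, h1, K, h2, h3⟩
      have h4 := hWs h2
      have h5 := hW h1
      have h6 := cuts_inert.1 h3
      rw [cuts_star] at h5 h6 ⊢
      exact ⟨h5.1.trans (h4.1.trans h6.1), by omega⟩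
    · rintro ⟨h, hs⟩
      obtain ⟨K, h1, h2⟩ := reflTransGen_of_inert (fun _ _ => ih) (cuts_star.1 h)
      rcases h1.cases_head with rfl | ⟨H, hH, h3⟩
      · exact absurd (cuts_inert.1 h2).2 hs.ne
      · exact ⟨H, hH, K, h3, h2⟩

theorem consuming_proper (e : GExpr Voc i j) : e.proper.Consuming := by
  induction e with
  | empty => trivial
  | graph K => rw [proper]; split_ifs <;> trivial
  | union e₁ e₂ ih₁ ih₂ => exact ⟨ih₁, ih₂⟩
  | concat e₁ e₂ ih₁ ih₂ =>
    exact ⟨⟨ih₁, consuming_inert _, ih₂⟩, consuming_inert _, ih₂⟩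
  | star e ih =>
    refine ⟨⟨consuming_inert _, ih⟩, ⟨⟨consuming_inert _, ih⟩, fun G G' h => ?_⟩,
      consuming_inert _⟩
    obtain ⟨H, h1, h2⟩ := cuts_concat.1 h
    rw [cuts_inert] at h1
    rw [cuts_proper] at h2
    omega

/-- An expression with the same cuts as `e` in which all iterations are consuming. -/
noncomputable def normalize (e : GExpr Voc i j) : GExpr Voc i j := .union e.inert e.proper

theorem cuts_normalize {e : GExpr Voc i j} {G : FGraph Voc i} {G' : FGraph Voc j} :
    e.normalize.Cuts G G' ↔ e.Cuts G G' := by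
  rw [normalize, cuts_union]
  exact (cuts_inert_or fun _ _ => cuts_proper).symm

theorem consuming_normalize (e : GExpr Voc i j) : e.normalize.Consuming :=
  ⟨consuming_inert e, consuming_proper e⟩

end GExpr

/-! ### Values of configurations -/

theorem Graph.finite_isFrontal (G : Graph Voc) : {P : Graph Voc | P.IsFrontal G}.Finite := by
  have hl : {l : List ℕ | l.Nodup ∧ ∀ v ∈ l, v ∈ G.nodes}.Finite := by
    refine ((List.finite_length_le {v // v ∈ G.nodes} G.nodes.card).image
      (List.map Subtype.val)).subset ?_
    rintro l ⟨hn, hl⟩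
    refine ⟨l.attachWith _ hl, ?_, by simp⟩
    rw [Set.mem_ofPred_eq, List.length_attachWith, ← List.toFinset_card_of_nodup hn]
    exact Finset.card_le_card fun v hv => hl v (List.mem_toFinset.1 hv)
  refine Set.Finite.of_finite_image (f := fun P => (P.nodes, P.edges, P.rear))
    ((G.nodes.powerset.finite_toSet.prod (G.edges.powerset.finite_toSet.prod hl)).subset ?_) ?_
  · rintro _ ⟨P, hP, rfl⟩
    exact ⟨by simpa using hP.nodes_sub, by simpa using hP.edges_sub, P.rear_nodup,
      fun v hv => hP.nodes_sub (P.rear_mem v hv)⟩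
  · intro P hP Q hQ h
    simp only [Prod.mk.injEq] at h
    refine Graph.ext_of_att h.1 h.2.1 (fun e h1 h2 => ?_) (hP.front_eq.trans hQ.front_eq.symm)
      h.2.2
    have h3 := hP.edge_eq e h1 (hP.edges_sub h1)
    have h4 := hQ.edge_eq e h2 (hP.edges_sub h1)
    exact ⟨h3.2.trans h4.2.symm, h3.1.trans h4.1.symm⟩

theorem GExpr.finite_cuts {i j : ℕ} (e : GExpr Voc i j) (G : FGraph Voc i) :
    {G' | e.Cuts G G'}.Finite := by
  classical
  have h1 : {P : TGraph Voc i j | P.1.IsFrontal G.1}.Finite :=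
    (Graph.finite_isFrontal G.1).preimage Subtype.val_injective.injOn
  refine (h1.image fun P => if h : P.1.IsFrontal G.1 then
    (⟨G.1.cut P.1 h, P.2.2⟩ : FGraph Voc j) else ⟨P.1.cut P.1 ⟨subset_rfl, subset_rfl,
      fun _ _ _ => ⟨rfl, rfl⟩, rfl, fun _ _ h => h⟩, P.2.2⟩).subset ?_
  rintro _ ⟨P, h, -, rfl⟩
  exact ⟨P, h, dif_pos h⟩

theorem step_ex {F : FormulaSystem Voc X} {m i : ℕ} {e : GExpr Voc m i} {f : Formula Voc X i}
    {G : FGraph Voc m} {s : Sign} {c : Config Voc X} :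
    Step F ⟨m, .ex e f, G, s⟩ c ↔ ∃ G', e.Cuts G G' ∧ c = ⟨i, f, G', s⟩ := by
  constructor
  · rintro ⟨P, h, hP, rfl⟩
    exact ⟨_, ⟨P, h, hP, rfl⟩, rfl⟩
  · rintro ⟨_, ⟨P, h, hP, rfl⟩, rfl⟩
    exact ⟨P, h, hP, rfl⟩

theorem step_all {F : FormulaSystem Voc X} {m i : ℕ} {e : GExpr Voc m i} {f : Formula Voc X i}
    {G : FGraph Voc m} {s : Sign} {c : Config Voc X} :
    Step F ⟨m, .all e f, G, s⟩ c ↔ ∃ G', e.Cuts G G' ∧ c = ⟨i, f, G', s⟩ := by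
  constructor
  · rintro ⟨P, h, hP, rfl⟩
    exact ⟨_, ⟨P, h, hP, rfl⟩, rfl⟩
  · rintro ⟨_, ⟨P, h, hP, rfl⟩, rfl⟩
    exact ⟨P, h, hP, rfl⟩

theorem finite_step (F : FormulaSystem Voc X) (c : Config Voc X) : {c' | Step F c c'}.Finite := by
  obtain ⟨m, f, G, s⟩ := c
  cases f with
  | tru | fls => simp [Step]
  | var | neg => simp [Step]
  | ex e f =>
    refine ((e.finite_cuts G).image fun G' => (⟨_, f, G', s⟩ : Config Voc X)).subset ?_
    intro c hc
    rw [Set.mem_ofPred_eq, step_ex] at hc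
    obtain ⟨G', h, rfl⟩ := hc
    exact ⟨G', h, rfl⟩
  | all e f =>
    refine ((e.finite_cuts G).image fun G' => (⟨_, f, G', s⟩ : Config Voc X)).subset ?_
    intro c hc
    rw [Set.mem_ofPred_eq, step_all] at hc
    obtain ⟨G', h, rfl⟩ := hc
    exact ⟨G', h, rfl⟩
  | and f g | or f g =>
    refine (Set.toFinite {⟨m, f, G, s⟩, ⟨m, g, G, s⟩}).subset fun c hc => ?_
    simpa [Step] using hc

/-- The evaluation graph of all configurations, with no restriction to reachable ones. -/
abbrev configGraph (F : FormulaSystem Voc X) : EvalGraph where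
  Node := Config Voc X
  Universal := Config.Universal
  Edge := Step F

theorem value_eq_some_iff {F : FormulaSystem Voc X} {x : X} {G : FGraph Voc (X.rank x)}
    {b : Bool} : value F x G = some b ↔ (configGraph F).Val (initConfig x G) b := by
  refine (EvalGraph.evoStar_eq_some_iff_val (E := FCG F x G) ?_ _ b).trans ?_
  · exact fun c => (finite_step F c.1).preimage Subtype.val_injective.injOn
  · refine (EvalGraph.val_map (E := FCG F x G) (E' := configGraph F) Subtype.val
      (fun _ => Iff.rfl) (fun c d => ⟨fun h => ⟨⟨d, c.2.tail h⟩, h, rfl⟩, ?_⟩) _ b).symm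
    rintro ⟨c', h, rfl⟩
    exact h

/-! ### Normalized formulas -/

namespace Formula

/-- All expressions in the formula iterate only over consuming expressions. -/
def Consuming : {m : ℕ} → Formula Voc X m → Prop
  | _, .tru => True
  | _, .fls => True
  | _, .var _ _ => True
  | _, .ex e f => e.Consuming ∧ f.Consuming
  | _, .all e f => e.Consuming ∧ f.Consuming
  | _, .neg f => f.Consuming
  | _, .and f g => f.Consuming ∧ g.Consuming
  | _, .or f g => f.Consuming ∧ g.Consuming

/-- Normalization of all expressions in a formula. -/
noncomputable def normalize : {m : ℕ} → Formula Voc X m → Formula Voc X m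
  | _, .tru => .tru
  | _, .fls => .fls
  | _, .var x hx => .var x hx
  | _, .ex e f => .ex e.normalize f.normalize
  | _, .all e f => .all e.normalize f.normalize
  | _, .neg f => .neg f.normalize
  | _, .and f g => .and f.normalize g.normalize
  | _, .or f g => .or f.normalize g.normalize

theorem consuming_normalize {m : ℕ} (f : Formula Voc X m) : f.normalize.Consuming := by
  induction f with
  | tru | fls | var => trivial
  | ex e f ih | all e f ih => exact ⟨e.consuming_normalize, ih⟩
  | neg f ih => exact ih
  | and f g ih₁ ih₂ | or f g ih₁ ih₂ => exact ⟨ih₁, ih₂⟩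

theorem conjunctive_normalize {m : ℕ} (f : Formula Voc X m) :
    f.normalize.Conjunctive ↔ f.Conjunctive := by
  cases f <;> rfl

end Formula

/-- Normalization of the formula of a configuration. -/
noncomputable def Config.normalize (c : Config Voc X) : Config Voc X :=
  ⟨c.type, c.formula.normalize, c.graph, c.sign⟩

theorem val_normalize {F : FormulaSystem Voc X} {c : Config Voc X} {b : Bool} :
    (configGraph fun x => (F x).normalize).Val c.normalize b ↔ (configGraph F).Val c b := by
  refine EvalGraph.val_map (E := configGraph F) (E' := configGraph fun x => (F x).normalize)
    Config.normalize (fun c => ?_) (fun c d => ?_) c b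
  · simp only [Config.Universal, Config.normalize, Formula.conjunctive_normalize]
  · obtain ⟨m, f, G, s⟩ := c
    cases f with
    | tru | fls => simp [configGraph, Config.normalize, Formula.normalize, Step]
    | var | neg =>
      simp only [configGraph, Config.normalize, Formula.normalize, Step, exists_eq_left]
      exact eq_comm
    | ex e f =>
      simp only [configGraph, Config.normalize, Formula.normalize, step_ex, GExpr.cuts_normalize]
      constructor
      · rintro ⟨G', h, rfl⟩
        exact ⟨_, ⟨G', h, rfl⟩, rfl⟩
      · rintro ⟨_, ⟨G', h, rfl⟩, rfl⟩
        exact ⟨G', h, rfl⟩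
    | all e f =>
      simp only [configGraph, Config.normalize, Formula.normalize, step_all, GExpr.cuts_normalize]
      constructor
      · rintro ⟨G', h, rfl⟩
        exact ⟨_, ⟨G', h, rfl⟩, rfl⟩
      · rintro ⟨_, ⟨G', h, rfl⟩, rfl⟩
        exact ⟨G', h, rfl⟩
    | and f g | or f g =>
      simp only [configGraph, Config.normalize, Formula.normalize, Step]
      constructor
      · rintro (rfl | rfl)
        exacts [⟨_, Or.inl rfl, rfl⟩, ⟨_, Or.inr rfl, rfl⟩]
      · rintro ⟨_, rfl | rfl, rfl⟩
        exacts [Or.inl rfl, Or.inr rfl]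

/-! ### Unfolding formulas into shallow shapes -/

/-- The Boolean value of a sign; `true` for the positive sign. -/
def Sign.isPos : Sign → Bool
  | .pos => true
  | .neg => false

/-- The quantified formula with quantifier `∀` if `a` is true, and `∃` otherwise. -/
def Formula.quant {m i : ℕ} : Bool → GExpr Voc m i → Formula Voc X i → Formula Voc X m
  | true, e, f => .all e f
  | false, e, f => .ex e f

/-- The shapes of shallow formulas, with signed formulas in place of variables. The flag `u` tells
whether a shape is universal: `leaf` stands for `true` or `false`, `bin` for `∧` or `∨`, and
`cut` for `∀` or `∃` with a single graph. -/
inductive Shape (Voc : RankedSet.{u}) (X : RankedSet.{v}) (m : ℕ) : Type (max u v)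
  | leaf (u : Bool) : Shape Voc X m
  | bin (u : Bool) (s : Sign) (f g : Formula Voc X m) : Shape Voc X m
  | cut (u : Bool) (s : Sign) {i : ℕ} (K : TGraph Voc m i) (f : Formula Voc X i) : Shape Voc X m

namespace Shape

/-- Whether a shape is universal. -/
def isUniversal {m : ℕ} : Shape Voc X m → Bool
  | .leaf u => u
  | .bin u _ _ _ => u
  | .cut u _ _ _ => u

/-- The successors of a shape at a graph. -/
def Succ {m : ℕ} : Shape Voc X m → FGraph Voc m → Config Voc X → Prop
  | .leaf _, _, _ => False
  | .bin _ s f g, G, c => c = ⟨m, f, G, s⟩ ∨ c = ⟨m, g, G, s⟩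
  | .cut (i := i) _ s K f, G, c => ∃ G', (GExpr.graph K).Cuts G G' ∧ c = ⟨i, f, G', s⟩

end Shape

/-- The unfolding of a quantified formula by one step in the structure of its expression. -/
def quantShape (a : Bool) : {m i : ℕ} → GExpr Voc m i → Formula Voc X i → Sign → Shape Voc X m
  | _, _, .empty, _, s => .leaf (a == s.isPos)
  | _, _, .graph K, f, s => .cut (a == s.isPos) s K f
  | _, _, .union e₁ e₂, f, s => .bin (a == s.isPos) s (.quant a e₁ f) (.quant a e₂ f)
  | _, _, .concat e₁ e₂, f, s =>
    .bin (a == s.isPos) s (.quant a e₁ (.quant a e₂ f)) (.quant a e₁ (.quant a e₂ f))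
  | _, _, .star e, f, s => .bin (a == s.isPos) s f (.quant a e (.quant a e.star f))

/-- The unfolding of a signed formula. A negative sign dualizes the formula. Where there is only
one successor, it is repeated. -/
def Formula.shape (F : FormulaSystem Voc X) : {m : ℕ} → Formula Voc X m → Sign → Shape Voc X m
  | _, .tru, s => .leaf s.isPos
  | _, .fls, s => .leaf (!s.isPos)
  | _, .var x hx, s => .bin true s (hx ▸ F x) (hx ▸ F x)
  | _, .ex e f, s => quantShape false e f s
  | _, .all e f, s => quantShape true e f s
  | _, .neg f, s => .bin true s.flip f f
  | _, .and f g, s => .bin s.isPos s f g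
  | _, .or f g, s => .bin (!s.isPos) s f g

/-- The evaluation graph of all configurations in which formulas are evaluated according to their
shapes. -/
abbrev shapeGraph (F : FormulaSystem Voc X) : EvalGraph where
  Node := Config Voc X
  Universal c := (c.formula.shape F c.sign).isUniversal = true
  Edge c := (c.formula.shape F c.sign).Succ c.graph

/-- `P` holds of all elements of `S` if `u` equals `b`, and of some element of `S` otherwise. -/
def Branch {α : Type*} (u b : Bool) (S P : α → Prop) : Prop :=
  (u = b ∧ ∀ x, S x → P x) ∨ (u ≠ b ∧ ∃ x, S x ∧ P x)

theorem EvalGraph.forced_iff_branch {E : EvalGraph.{u}} {P : E.Node → Bool → Prop} {c : E.Node}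
    {b u : Bool} (hu : E.Universal c ↔ u = true) :
    E.Forced P c b ↔ Branch u b (E.Edge c) fun c' => P c' b := by
  rw [EvalGraph.Forced, Branch, hu, ← Bool.eq_iff_iff]

/-- The condition under which a shape receives the value `b` at `G`, where `P` tells which
configurations have this value. -/
def Shape.Holds {m : ℕ} (b : Bool) (P : Config Voc X → Prop) : Shape Voc X m → FGraph Voc m → Prop
  | .leaf u, _ => u = b
  | .bin u s f g, G => (u = b ∧ P ⟨m, f, G, s⟩ ∧ P ⟨m, g, G, s⟩) ∨
      (u ≠ b ∧ (P ⟨m, f, G, s⟩ ∨ P ⟨m, g, G, s⟩))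
  | .cut (i := i) u s K f, G => Branch u b ((GExpr.graph K).Cuts G) fun G' => P ⟨i, f, G', s⟩

theorem Shape.branch_succ_iff {m : ℕ} {b : Bool} {P : Config Voc X → Prop} {S : Shape Voc X m}
    {G : FGraph Voc m} : Branch S.isUniversal b (S.Succ G) P ↔ S.Holds b P G := by
  cases S with
  | leaf u => simp [Branch, isUniversal, Succ, Holds]
  | bin u s f g => simp [Branch, isUniversal, Succ, Holds]
  | cut u s K f =>
    simp only [Branch, isUniversal, Succ, Holds]
    grind

theorem forced_shapeGraph {F : FormulaSystem Voc X} {P : Config Voc X → Bool → Prop}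
    {c : Config Voc X} {b : Bool} : (shapeGraph F).Forced P c b ↔
      (c.formula.shape F c.sign).Holds b (fun c' => P c' b) c.graph :=
  (EvalGraph.forced_iff_branch Iff.rfl).trans Shape.branch_succ_iff

theorem forced_quant {F : FormulaSystem Voc X} {P : Config Voc X → Bool → Prop} {a b : Bool}
    {m i : ℕ} {e : GExpr Voc m i} {f : Formula Voc X i} {G : FGraph Voc m} {s : Sign} :
    (configGraph F).Forced P ⟨m, .quant a e f, G, s⟩ b ↔
      Branch (a == s.isPos) b (e.Cuts G) fun G' => P ⟨i, f, G', s⟩ b := by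
  rw [EvalGraph.forced_iff_branch (u := a == s.isPos)
    (by cases a <;> cases s <;>
      simp [Config.Universal, Formula.quant, Formula.Conjunctive, Sign.isPos])]
  have : ∀ c, Step F ⟨m, .quant a e f, G, s⟩ c ↔
      ∃ G', e.Cuts G G' ∧ c = ⟨i, f, G', s⟩ := by
    intro c
    cases a
    · simp only [Formula.quant, step_ex]
    · simp only [Formula.quant, step_all]
  simp only [Branch, configGraph, this]
  grind

/-- The formulas that are not quantified. -/
def Formula.Propositional : {m : ℕ} → Formula Voc X m → Prop
  | _, .ex _ _ => False
  | _, .all _ _ => False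
  | _, _ => True

theorem forced_propositional {F : FormulaSystem Voc X} {P : Config Voc X → Bool → Prop}
    {c : Config Voc X} {b : Bool} (hc : c.formula.Propositional) :
    (configGraph F).Forced P c b ↔ (shapeGraph F).Forced P c b := by
  obtain ⟨m, f, G, s⟩ := c
  rw [forced_shapeGraph]
  cases f with
  | ex => exact hc.elim
  | all => exact hc.elim
  | var x hx =>
    subst hx
    cases s <;> cases b <;> simp [EvalGraph.Forced, configGraph, Config.Universal,
      Formula.Conjunctive, Step, Formula.shape, Shape.Holds]
  | _ =>
    cases s <;> cases b <;> simp [EvalGraph.Forced, configGraph, Config.Universal,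
      Formula.Conjunctive, Step, Formula.shape, Shape.Holds, Sign.isPos, Sign.flip]

/-! ### Shapes compute the values -/

theorem shape_quant {F : FormulaSystem Voc X} {a : Bool} {m i : ℕ} {e : GExpr Voc m i}
    {f : Formula Voc X i} {s : Sign} : (Formula.quant a e f).shape F s = quantShape a e f s := by
  cases a <;> rfl

theorem val_quant {F : FormulaSystem Voc X} {a b : Bool} {m i : ℕ} {e : GExpr Voc m i}
    {f : Formula Voc X i} {G : FGraph Voc m} {s : Sign} :
    (configGraph F).Val ⟨m, .quant a e f, G, s⟩ b ↔
      Branch (a == s.isPos) b (e.Cuts G) fun G' => (configGraph F).Val ⟨i, f, G', s⟩ b :=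
  EvalGraph.val_iff_forced.trans forced_quant

theorem val_shapeGraph_quant {F : FormulaSystem Voc X} {a b : Bool} {m i : ℕ} {e : GExpr Voc m i}
    {f : Formula Voc X i} {G : FGraph Voc m} {s : Sign} :
    (shapeGraph F).Val ⟨m, .quant a e f, G, s⟩ b ↔
      (quantShape a e f s).Holds b (fun c => (shapeGraph F).Val c b) G := by
  rw [EvalGraph.val_iff_forced, forced_shapeGraph, shape_quant]

/-- The unfolding of a quantified formula is correct for the values of configurations: successive
unfoldings amount to cutting along the whole expression. -/
theorem val_of_holds_quantShape {F : FormulaSystem Voc X} {a b : Bool} {m i : ℕ}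
    {e : GExpr Voc m i} {f : Formula Voc X i} {G : FGraph Voc m} {s : Sign}
    (h : (quantShape a e f s).Holds b (fun c => (configGraph F).Val c b) G) :
    (configGraph F).Val ⟨m, .quant a e f, G, s⟩ b := by
  rw [val_quant]
  cases e with
  | empty => simpa [quantShape, Shape.Holds, Branch, GExpr.not_cuts_empty] using h
  | graph K => exact h
  | union e₁ e₂ =>
    simp only [quantShape, Shape.Holds, val_quant, Branch, GExpr.cuts_union] at h ⊢
    grind
  | concat e₁ e₂ =>
    simp only [quantShape, Shape.Holds, val_quant, Branch, GExpr.cuts_concat] at h ⊢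
    grind
  | star e =>
    simp only [quantShape, Shape.Holds, val_quant, Branch, GExpr.cuts_star] at h ⊢
    rcases h with ⟨hu, h1, h2⟩ | ⟨hu, h1 | h2⟩
    · refine Or.inl ⟨hu, fun G' hG' => ?_⟩
      rcases hG'.cases_head with rfl | ⟨H, hH, hG'⟩
      · exact h1
      · grind
    · exact Or.inr ⟨hu, G, .refl, h1⟩
    · obtain ⟨H, hH, h3⟩ := (h2.resolve_left fun h => hu h.1).2
      obtain ⟨G', hG', h4⟩ := (h3.resolve_left fun h => hu h.1).2
      exact Or.inr ⟨hu, G', .head hH hG', h4⟩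

/-- If all iterations in the expression are consuming, then the successive unfoldings of a
quantified formula reach a value whenever cutting along the whole expression does. Without this
condition, an iteration might be unfolded forever. -/
theorem val_shapeGraph_of_branch {F : FormulaSystem Voc X} {a b : Bool} {m i : ℕ}
    {e : GExpr Voc m i} (he : e.Consuming) {f : Formula Voc X i} {G : FGraph Voc m} {s : Sign}
    (h : Branch (a == s.isPos) b (e.Cuts G) fun G' => (shapeGraph F).Val ⟨i, f, G', s⟩ b) :
    (shapeGraph F).Val ⟨m, .quant a e f, G, s⟩ b := by
  induction e with
  | empty =>
    rw [val_shapeGraph_quant]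
    simpa [quantShape, Shape.Holds, Branch, GExpr.not_cuts_empty] using h
  | graph K =>
    rw [val_shapeGraph_quant]
    exact h
  | union e₁ e₂ ih₁ ih₂ =>
    rw [val_shapeGraph_quant]
    simp only [Branch, GExpr.cuts_union] at h
    rcases h with ⟨hu, h⟩ | ⟨hu, G', h | h, hv⟩
    · exact Or.inl ⟨hu, ih₁ he.1 (Or.inl ⟨hu, fun G' hG' => h G' (Or.inl hG')⟩),
        ih₂ he.2 (Or.inl ⟨hu, fun G' hG' => h G' (Or.inr hG')⟩)⟩
    · exact Or.inr ⟨hu, Or.inl (ih₁ he.1 (Or.inr ⟨hu, G', h, hv⟩))⟩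
    · exact Or.inr ⟨hu, Or.inr (ih₂ he.2 (Or.inr ⟨hu, G', h, hv⟩))⟩
  | concat e₁ e₂ ih₁ ih₂ =>
    rw [val_shapeGraph_quant]
    simp only [Branch, GExpr.cuts_concat] at h
    rcases h with ⟨hu, h⟩ | ⟨hu, G', ⟨H, h1, h2⟩, hv⟩
    · have := ih₁ (f := .quant a e₂ f) (G := G) he.1 (Or.inl ⟨hu, fun H h1 =>
        ih₂ he.2 (Or.inl ⟨hu, fun G' h2 => h G' ⟨H, h1, h2⟩⟩)⟩)
      exact Or.inl ⟨hu, this, this⟩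
    · exact Or.inr ⟨hu, Or.inl (ih₁ he.1 (Or.inr ⟨hu, H, h1, ih₂ he.2 (Or.inr ⟨hu, G', h2, hv⟩)⟩))⟩
  | star e ih =>
    simp only [Branch, GExpr.cuts_star] at h
    rcases h with ⟨hu, h⟩ | ⟨hu, G', hG', hv⟩
    · induction hn : G.1.size using Nat.strong_induction_on generalizing G with
      | _ n ihn =>
        subst hn
        rw [val_shapeGraph_quant]
        exact Or.inl ⟨hu, h G .refl, ih he.1 (Or.inl ⟨hu, fun H hH =>
          ihn _ (he.2 G H hH) (fun G' hG' => h G' (.head hH hG')) rfl⟩)⟩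
    · induction hG' using Relation.ReflTransGen.head_induction_on with
      | refl =>
        rw [val_shapeGraph_quant]
        exact Or.inr ⟨hu, Or.inl hv⟩
      | head hH _ ih' =>
        rw [val_shapeGraph_quant]
        exact Or.inr ⟨hu, Or.inr (ih he.1 (Or.inr ⟨hu, _, hH, ih'⟩))⟩

theorem val_of_val_shapeGraph {F : FormulaSystem Voc X} {c : Config Voc X} {b : Bool}
    (h : (shapeGraph F).Val c b) : (configGraph F).Val c b := by
  refine EvalGraph.Val.least (E := shapeGraph F) (P := (configGraph F).Val) (fun c b h => ?_) h
  by_cases hc : c.formula.Propositional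
  · exact EvalGraph.val_iff_forced.2 ((forced_propositional hc).2 h)
  · rw [forced_shapeGraph] at h
    obtain ⟨m, f, G, s⟩ := c
    cases f with
    | ex e f => exact val_of_holds_quantShape (a := false) h
    | all e f => exact val_of_holds_quantShape (a := true) h
    | _ => exact absurd trivial hc

theorem val_shapeGraph_of_val {F : FormulaSystem Voc X} (hF : ∀ x, (F x).Consuming)
    {c : Config Voc X} {b : Bool} (h : (configGraph F).Val c b) (hc : c.formula.Consuming) :
    (shapeGraph F).Val c b := by
  refine EvalGraph.Val.least (E := configGraph F)
    (P := fun c b => c.formula.Consuming → (shapeGraph F).Val c b) (fun c b h hc => ?_) h hc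
  obtain ⟨m, f, G, s⟩ := c
  cases f with
  | @ex _ i e f =>
    have h' := (forced_quant (a := false)).1 h
    simp only [hc.2, true_imp_iff] at h'
    exact val_shapeGraph_of_branch (a := false) hc.1 h'
  | all e f =>
    have h' := (forced_quant (a := true)).1 h
    simp only [hc.2, true_imp_iff] at h'
    exact val_shapeGraph_of_branch (a := true) hc.1 h'
  | var x hx =>
    subst hx
    replace h := forced_shapeGraph.1 ((forced_propositional (by exact trivial)).1 h)
    rw [EvalGraph.val_iff_forced, forced_shapeGraph]
    simpa only [Formula.shape, Shape.Holds, hF, true_imp_iff] using h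
  | tru | fls =>
    replace h := forced_shapeGraph.1 ((forced_propositional (by exact trivial)).1 h)
    rw [EvalGraph.val_iff_forced, forced_shapeGraph]
    exact h
  | neg f =>
    replace h := forced_shapeGraph.1 ((forced_propositional (by exact trivial)).1 h)
    rw [EvalGraph.val_iff_forced, forced_shapeGraph]
    change f.Consuming at hc
    simpa only [Formula.shape, Shape.Holds, hc, true_imp_iff] using h
  | and f g | or f g =>
    replace h := forced_shapeGraph.1 ((forced_propositional (by exact trivial)).1 h)
    rw [EvalGraph.val_iff_forced, forced_shapeGraph]
    simpa only [Formula.shape, Shape.Holds, hc.1, hc.2, true_imp_iff] using h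

theorem val_shapeGraph_iff {F : FormulaSystem Voc X} (hF : ∀ x, (F x).Consuming)
    {c : Config Voc X} {b : Bool} (hc : c.formula.Consuming) :
    (shapeGraph F).Val c b ↔ (configGraph F).Val c b :=
  ⟨val_of_val_shapeGraph, fun h => val_shapeGraph_of_val hF h hc⟩

/-! ### Finitely many signed formulas suffice -/

/-- Formulas of arbitrary type with a sign. -/
structure SignedFormula (Voc : RankedSet.{u}) (X : RankedSet.{v}) where
  type : ℕ
  formula : Formula Voc X type
  sign : Sign

namespace Shape

/-- All signed formulas that occur in the shape are in `Q`. -/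
def Within {m : ℕ} (Q : Set (SignedFormula Voc X)) : Shape Voc X m → Prop
  | .leaf _ => True
  | .bin _ s f g => ⟨m, f, s⟩ ∈ Q ∧ ⟨m, g, s⟩ ∈ Q
  | .cut (i := i) _ s _ f => ⟨i, f, s⟩ ∈ Q

end Shape

/-- The formulas that arise from a quantified formula by unfolding its expression. -/
def quantClosure (a : Bool) : {m i : ℕ} → GExpr Voc m i → Formula Voc X i →
    Set (Σ m, Formula Voc X m)
  | m, _, .empty, f => {⟨m, .quant a .empty f⟩}
  | m, _, .graph K, f => {⟨m, .quant a (.graph K) f⟩}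
  | m, _, .union e₁ e₂, f =>
    insert ⟨m, .quant a (.union e₁ e₂) f⟩ (quantClosure a e₁ f ∪ quantClosure a e₂ f)
  | m, _, .concat e₁ e₂, f => insert ⟨m, .quant a (.concat e₁ e₂) f⟩
    (quantClosure a e₁ (.quant a e₂ f) ∪ quantClosure a e₂ f)
  | m, _, .star e, f => insert ⟨m, .quant a (.star e) f⟩ (quantClosure a e (.quant a e.star f))

/-- The formulas that arise from a formula by unfolding, up to the unfolding of variables. -/
def Formula.closure : {m : ℕ} → Formula Voc X m → Set (Σ m, Formula Voc X m)
  | m, .tru => {⟨m, .tru⟩}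
  | m, .fls => {⟨m, .fls⟩}
  | m, .var x hx => {⟨m, .var x hx⟩}
  | _, .ex e f => quantClosure false e f ∪ f.closure
  | _, .all e f => quantClosure true e f ∪ f.closure
  | m, .neg f => insert ⟨m, .neg f⟩ f.closure
  | m, .and f g => insert ⟨m, .and f g⟩ (f.closure ∪ g.closure)
  | m, .or f g => insert ⟨m, .or f g⟩ (f.closure ∪ g.closure)

theorem finite_quantClosure {a : Bool} {m i : ℕ} (e : GExpr Voc m i) (f : Formula Voc X i) :
    (quantClosure a e f).Finite := by
  induction e with
  | empty | graph => exact Set.finite_singleton _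
  | union e₁ e₂ ih₁ ih₂ => exact ((ih₁ f).union (ih₂ f)).insert _
  | concat e₁ e₂ ih₁ ih₂ => exact ((ih₁ _).union (ih₂ f)).insert _
  | star e ih => exact (ih _).insert _

theorem Formula.finite_closure {m : ℕ} (f : Formula Voc X m) : f.closure.Finite := by
  induction f with
  | tru | fls | var => exact Set.finite_singleton _
  | ex e f ih | all e f ih => exact (finite_quantClosure e f).union ih
  | neg f ih => exact ih.insert _
  | and f g ih₁ ih₂ | or f g ih₁ ih₂ => exact (ih₁.union ih₂).insert _

theorem self_mem_quantClosure {a : Bool} {m i : ℕ} (e : GExpr Voc m i) (f : Formula Voc X i) :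
    (⟨m, .quant a e f⟩ : Σ m, Formula Voc X m) ∈ quantClosure a e f := by
  cases e <;> simp [quantClosure]

theorem Formula.self_mem_closure {m : ℕ} (f : Formula Voc X m) :
    (⟨m, f⟩ : Σ m, Formula Voc X m) ∈ f.closure := by
  cases f with
  | ex e f => exact Or.inl (self_mem_quantClosure (a := false) e f)
  | all e f => exact Or.inl (self_mem_quantClosure (a := true) e f)
  | _ => simp [closure]

/-- A set of formulas, combined with both signs. -/
def withSigns (Q : Set (Σ m, Formula Voc X m)) : Set (SignedFormula Voc X) :=
  {q | ⟨q.type, q.formula⟩ ∈ Q}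

theorem finite_withSigns {Q : Set (Σ m, Formula Voc X m)} (hQ : Q.Finite) :
    (withSigns Q).Finite := by
  have hs : (Set.univ : Set Sign).Finite := by
    refine (Set.toFinite {Sign.pos, Sign.neg}).subset fun s _ => ?_
    cases s <;> simp
  refine ((hQ.prod hs).image fun p => ⟨p.1.1, p.1.2, p.2⟩).subset ?_
  rintro ⟨m, f, s⟩ h
  exact ⟨⟨⟨m, f⟩, s⟩, ⟨h, trivial⟩, rfl⟩

theorem quantShape_within {a : Bool} {m i : ℕ} {e : GExpr Voc m i} {f : Formula Voc X i}
    {Q : Set (Σ m, Formula Voc X m)} (hQ : quantClosure a e f ⊆ Q)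
    (hf : (⟨i, f⟩ : Σ m, Formula Voc X m) ∈ Q) :
    ∀ q ∈ quantClosure a e f, ∀ F s, (q.2.shape F s).Within (withSigns Q) := by
  induction e with
  | empty =>
    rintro _ rfl F s
    rw [shape_quant]
    trivial
  | graph K =>
    rintro _ rfl F s
    rw [shape_quant]
    exact hf
  | union e₁ e₂ ih₁ ih₂ =>
    have h1 := (Set.subset_union_left.trans (Set.subset_insert _ _)).trans hQ
    have h2 := (Set.subset_union_right.trans (Set.subset_insert _ _)).trans hQ
    rintro _ (rfl | h | h) F s
    · rw [shape_quant]
      exact ⟨h1 (self_mem_quantClosure _ _), h2 (self_mem_quantClosure _ _)⟩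
    · exact ih₁ h1 hf _ h F s
    · exact ih₂ h2 hf _ h F s
  | concat e₁ e₂ ih₁ ih₂ =>
    have h1 := (Set.subset_union_left.trans (Set.subset_insert _ _)).trans hQ
    have h2 := (Set.subset_union_right.trans (Set.subset_insert _ _)).trans hQ
    rintro _ (rfl | h | h) F s
    · rw [shape_quant]
      exact ⟨h1 (self_mem_quantClosure _ _), h1 (self_mem_quantClosure _ _)⟩
    · exact ih₁ h1 (h2 (self_mem_quantClosure _ _)) _ h F s
    · exact ih₂ h2 hf _ h F s
  | star e ih =>
    have h1 := (Set.subset_insert _ _).trans hQ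
    rintro _ (rfl | h) F s
    · rw [shape_quant]
      exact ⟨hf, h1 (self_mem_quantClosure _ _)⟩
    · exact ih h1 (hQ (Set.mem_insert _ _)) _ h F s

theorem Formula.shape_within {F : FormulaSystem Voc X} {Q : Set (Σ m, Formula Voc X m)}
    (hF : ∀ x, (⟨_, F x⟩ : Σ m, Formula Voc X m) ∈ Q) {m : ℕ} {f : Formula Voc X m}
    (hQ : f.closure ⊆ Q) : ∀ q ∈ f.closure, ∀ s, (q.2.shape F s).Within (withSigns Q) := by
  induction f with
  | tru | fls =>
    rintro _ rfl s
    trivial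
  | var x hx =>
    rintro _ rfl s
    subst hx
    exact ⟨hF x, hF x⟩
  | ex e f ih | all e f ih =>
    have h1 := Set.subset_union_left.trans hQ
    have h2 := Set.subset_union_right.trans hQ
    rintro _ (h | h) s
    · exact quantShape_within h1 (h2 f.self_mem_closure) _ h F s
    · exact ih h2 _ h s
  | neg f ih =>
    have h1 := (Set.subset_insert _ _).trans hQ
    rintro _ (rfl | h) s
    · exact ⟨h1 f.self_mem_closure, h1 f.self_mem_closure⟩
    · exact ih h1 _ h s
  | and f g ih₁ ih₂ | or f g ih₁ ih₂ =>
    have h1 := (Set.subset_union_left.trans (Set.subset_insert _ _)).trans hQ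
    have h2 := (Set.subset_union_right.trans (Set.subset_insert _ _)).trans hQ
    rintro _ (rfl | h | h) s
    · exact ⟨h1 f.self_mem_closure, h2 g.self_mem_closure⟩
    · exact ih₁ h1 _ h s
    · exact ih₂ h2 _ h s

/-- A finite set of signed formulas that contains all variables and is closed under unfolding. -/
theorem exists_finite_closed (F : FormulaSystem Voc X) :
    ∃ Q : Set (SignedFormula Voc X), Q.Finite ∧ (∀ x s, ⟨X.rank x, .var x rfl, s⟩ ∈ Q) ∧
      ∀ q ∈ Q, (q.formula.shape F q.sign).Within Q := by
  let Q : Set (Σ m, Formula Voc X m) :=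
    (⋃ x, (F x).closure) ∪ ⋃ x, (Formula.var x rfl : Formula Voc X (X.rank x)).closure
  have h1 : ∀ x, (F x).closure ⊆ Q := fun x =>
    (Set.subset_iUnion (fun x => (F x).closure) x).trans Set.subset_union_left
  have h2 : ∀ x, (Formula.var x rfl : Formula Voc X (X.rank x)).closure ⊆ Q := fun x =>
    (Set.subset_iUnion (fun x => (Formula.var x rfl : Formula Voc X (X.rank x)).closure) x).trans
      Set.subset_union_right
  have hF : ∀ x, (⟨_, F x⟩ : Σ m, Formula Voc X m) ∈ Q := fun x => h1 x (F x).self_mem_closure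
  refine ⟨withSigns Q, finite_withSigns ((Set.finite_iUnion fun x => (F x).finite_closure).union
    (Set.finite_iUnion fun x => Formula.finite_closure _)), fun x s => h2 x rfl, ?_⟩
  rintro ⟨m, f, s⟩ (h | h)
  · obtain ⟨x, hx⟩ := Set.mem_iUnion.1 h
    exact Formula.shape_within hF (h1 x) _ hx s
  · obtain ⟨x, hx⟩ := Set.mem_iUnion.1 h
    exact Formula.shape_within hF (h2 x) _ hx s

/-! ### Naming signed formulas by variables -/

variable {Y : RankedSet.{v}}

/-- `φ` is the shape `S`, with each signed formula `st y` that occurs in it replaced by a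
variable `y`. -/
inductive Shape.Named (st : Y → SignedFormula Voc X) : {m : ℕ} → Shape Voc X m →
    Formula Voc Y m → Prop
  | tru {m : ℕ} : Named st (.leaf true) (.tru (m := m))
  | fls {m : ℕ} : Named st (.leaf false) (.fls (m := m))
  | and {m : ℕ} (y z : Y) (hy : Y.rank y = m) (hz : Y.rank z = m) (s : Sign)
      (f g : Formula Voc X m) (hf : st y = ⟨m, f, s⟩) (hg : st z = ⟨m, g, s⟩) :
      Named st (.bin true s f g) (.and (.var y hy) (.var z hz))
  | or {m : ℕ} (y z : Y) (hy : Y.rank y = m) (hz : Y.rank z = m) (s : Sign)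
      (f g : Formula Voc X m) (hf : st y = ⟨m, f, s⟩) (hg : st z = ⟨m, g, s⟩) :
      Named st (.bin false s f g) (.or (.var y hy) (.var z hz))
  | all {m i : ℕ} (K : TGraph Voc m i) (y : Y) (hy : Y.rank y = i) (s : Sign)
      (f : Formula Voc X i) (hf : st y = ⟨i, f, s⟩) :
      Named st (.cut true s K f) (.all (.graph K) (.var y hy))
  | ex {m i : ℕ} (K : TGraph Voc m i) (y : Y) (hy : Y.rank y = i) (s : Sign)
      (f : Formula Voc X i) (hf : st y = ⟨i, f, s⟩) :
      Named st (.cut false s K f) (.ex (.graph K) (.var y hy))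

namespace Shape

theorem Named.isShallow {st : Y → SignedFormula Voc X} {m : ℕ} {S : Shape Voc X m}
    {φ : Formula Voc Y m} (h : Named st S φ) : φ.IsShallow := by
  cases h <;> constructor

theorem exists_named {st : Y → SignedFormula Voc X} (hst : ∀ y, Y.rank y = (st y).type) {m : ℕ}
    {S : Shape Voc X m} (hS : S.Within (Set.range st)) : ∃ φ, Named st S φ := by
  cases S with
  | leaf u => cases u; exacts [⟨_, .fls⟩, ⟨_, .tru⟩]
  | bin u s f g =>
    obtain ⟨⟨y, hy⟩, z, hz⟩ := hS
    have hy' : Y.rank y = m := by rw [hst, hy]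
    have hz' : Y.rank z = m := by rw [hst, hz]
    cases u
    exacts [⟨_, .or y z hy' hz' s f g hy hz⟩, ⟨_, .and y z hy' hz' s f g hy hz⟩]
  | cut u s K f =>
    obtain ⟨y, hy⟩ := hS
    have hy' := hst y
    rw [hy] at hy'
    cases u
    exacts [⟨_, .ex K y hy' s f hy⟩, ⟨_, .all K y hy' s f hy⟩]

/-- A shape and its named version have the same value at `G`, provided that corresponding
configurations have. -/
theorem Named.forced_iff {st : Y → SignedFormula Voc X} {m : ℕ} {S : Shape Voc X m}
    {φ : Formula Voc Y m} (h : Named st S φ) {F' : FormulaSystem Voc Y} {b : Bool}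
    {P : Config Voc Y → Bool → Prop} {P' : Config Voc X → Prop}
    (hP : ∀ (y : Y) (q : SignedFormula Voc X) (hy : Y.rank y = q.type) (G : FGraph Voc q.type),
      st y = q → (P ⟨q.type, .var y hy, G, .pos⟩ b ↔ P' ⟨q.type, q.formula, G, q.sign⟩))
    (G : FGraph Voc m) : (configGraph F').Forced P ⟨m, φ, G, .pos⟩ b ↔ S.Holds b P' G := by
  cases h with
  | tru | fls =>
    refine (forced_propositional (by exact trivial)).trans (forced_shapeGraph.trans ?_)
    exact Iff.rfl
  | and y z hy hz s f g hf hg | or y z hy hz s f g hf hg =>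
    refine (forced_propositional (by exact trivial)).trans (forced_shapeGraph.trans ?_)
    simp only [Formula.shape, Holds, Sign.isPos, hP y ⟨m, f, s⟩ hy G hf, hP z ⟨m, g, s⟩ hz G hg,
      Bool.not_true]
  | all K y hy s f hf =>
    refine (forced_quant (a := true)).trans ?_
    simp only [Holds, fun G => hP y ⟨_, f, s⟩ hy G hf]
    exact Iff.rfl
  | ex K y hy s f hf =>
    refine (forced_quant (a := false)).trans ?_
    simp only [Holds, fun G => hP y ⟨_, f, s⟩ hy G hf]
    exact Iff.rfl

end Shape

/-- The variables that name the signed formulas `st y`. -/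
abbrev nameSet {α : Type v} [Finite α] (st : α → SignedFormula Voc X) : RankedSet.{v} where
  carrier := α
  rank y := (st y).type

theorem val_var {F : FormulaSystem Voc X} {m : ℕ} {x : X} {hx : X.rank x = m} {G : FGraph Voc m}
    {s : Sign} {b : Bool} : (configGraph F).Val ⟨m, .var x hx, G, s⟩ b ↔
      (configGraph F).Val ⟨X.rank x, F x, ⟨G.1, G.2.trans hx.symm⟩, s⟩ b := by
  subst hx
  rw [EvalGraph.val_iff_forced]
  refine (forced_propositional (by exact trivial)).trans (forced_shapeGraph.trans ?_)
  simp only [Formula.shape, Shape.Holds, and_self, or_self, ← or_and_right, ne_eq, em, true_and]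

theorem Config.var_injective {m n : ℕ} {x y : X} {hx : X.rank x = m} {hy : X.rank y = n}
    {G : FGraph Voc m} {H : FGraph Voc n} {s t : Sign}
    (h : (⟨m, .var x hx, G, s⟩ : Config Voc X) = ⟨n, .var y hy, H, t⟩) : x = y ∧ G.1 = H.1 := by
  cases h
  exact ⟨rfl, rfl⟩

/-- A system that implements the shapes of the named signed formulas computes their values. -/
theorem val_named {F : FormulaSystem Voc X} {α : Type v} [Finite α]
    {st : α → SignedFormula Voc X} (hst : Function.Injective st)
    {F' : FormulaSystem Voc (nameSet st)}
    (hF' : ∀ y, Shape.Named (Y := nameSet st) st ((st y).formula.shape F (st y).sign) (F' y))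
    {b : Bool} {y : α} {q : SignedFormula Voc X} (hq : st y = q) (hy : (st y).type = q.type)
    {G : FGraph Voc q.type} :
    (configGraph F').Val ⟨q.type, .var y hy, G, .pos⟩ b ↔
      (shapeGraph F).Val ⟨q.type, q.formula, G, q.sign⟩ b := by
  constructor
  · intro h
    -- a derivation passes alternately through variables and the formulas assigned to them;
    -- `P` is the claim for the former and `P'` for the latter
    let P : Config Voc (nameSet st) → Bool → Prop := fun c b => ∀ (y : α) (G : FGraph Voc _),
      c = ⟨(st y).type, .var y rfl, G, .pos⟩ →
        (shapeGraph F).Val ⟨(st y).type, (st y).formula, G, (st y).sign⟩ b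
    let P' : Config Voc (nameSet st) → Bool → Prop := fun c b => ∀ (y : α) (G : FGraph Voc _),
      c = ⟨(st y).type, F' y, G, .pos⟩ →
        (shapeGraph F).Val ⟨(st y).type, (st y).formula, G, (st y).sign⟩ b
    suffices H : P ⟨q.type, .var y hy, G, .pos⟩ b by
      subst hq
      exact H y G rfl
    refine (EvalGraph.Val.least (E := configGraph F') (P := fun c b => P c b ∧ P' c b)
      (fun c b hc => ⟨?_, ?_⟩) h).1
    · rintro y G rfl
      replace hc := forced_shapeGraph.1 ((forced_propositional (by exact trivial)).1 hc)
      simp only [Formula.shape, Shape.Holds, and_self, or_self, ← or_and_right, ne_eq, em,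
        true_and] at hc
      exact hc.2 y G rfl
    · rintro y G rfl
      rw [EvalGraph.val_iff_forced, forced_shapeGraph, ← (hF' y).forced_iff (F' := F') (P := P)]
      · rcases hc with ⟨hu, hc⟩ | ⟨hu, c', hc', hc⟩
        exacts [Or.inl ⟨hu, fun c' hc' => (hc c' hc').1⟩, Or.inr ⟨hu, c', hc', hc.1⟩]
      · rintro y _ hy G rfl
        refine ⟨fun h => h y G rfl, fun h z H hz => ?_⟩
        obtain ⟨rfl, hGH⟩ := Config.var_injective hz
        obtain rfl := Subtype.ext hGH
        exact h
  · intro h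
    let P : Config Voc X → Bool → Prop := fun c b => ∀ (y : α)
      (hy : (st y).type = c.type), st y = ⟨c.type, c.formula, c.sign⟩ →
        (configGraph F').Val ⟨c.type, .var y hy, c.graph, .pos⟩ b
    suffices H : P ⟨q.type, q.formula, G, q.sign⟩ b from H y hy hq
    refine EvalGraph.Val.least (E := shapeGraph F) (P := P) ?_ h
    have hstep : ∀ (b : Bool) (y : α) (q : SignedFormula Voc X) (hy : (st y).type = q.type)
        (G : FGraph Voc q.type), st y = q →
        (shapeGraph F).Forced P ⟨q.type, q.formula, G, q.sign⟩ b →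
          (configGraph F').Val ⟨q.type, .var y hy, G, .pos⟩ b := by
      rintro b y _ hy G rfl hc
      rw [val_var, EvalGraph.val_iff_forced]
      refine ((hF' y).forced_iff (F' := F') ?_ _).2 (forced_shapeGraph.1 hc)
      rintro y _ hy G rfl
      refine ⟨fun h z hz hzy => ?_, fun h => h y hy rfl⟩
      obtain rfl := hst hzy
      exact h
    exact fun c b hc y hy hq => hstep b y ⟨c.type, c.formula, c.sign⟩ hy c.graph hq hc

end GraphFormula

theorem mainTheorem2 {Voc : GraphFormula.RankedSet.{u}} {X : GraphFormula.RankedSet.{v}}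
    (F : GraphFormula.FormulaSystem Voc X) :
    ∃ (X' : GraphFormula.RankedSet.{v}) (ι : X ↪ X') (F' : GraphFormula.FormulaSystem Voc X'),
      (∀ x : X, X'.rank (ι x) = X.rank x) ∧
      (∀ x : X, GraphFormula.lowerLang F' (ι x) = GraphFormula.lowerLang F x ∧
        GraphFormula.upperLang F' (ι x) = GraphFormula.upperLang F x) ∧
      (∀ x : X', (F' x).IsShallow) := by
  open GraphFormula in
  let F₁ : FormulaSystem Voc X := fun x => (F x).normalize
  obtain ⟨Q, hfin, hvar, hQ⟩ := exists_finite_closed F₁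
  have := hfin.to_subtype
  obtain ⟨n, ⟨ε⟩⟩ := Finite.exists_equiv_fin Q
  -- the signed formulas live in a larger universe than the variables, so they are numbered
  let st : ULift.{v} (Fin n) → SignedFormula Voc X := fun y => (ε.symm y.down).1
  have hst : Function.Injective st := fun y z h =>
    ULift.down_injective (ε.symm.injective (Subtype.ext h))
  have hrange : Set.range st = Q := by
    ext q
    constructor
    · rintro ⟨y, rfl⟩
      exact (ε.symm y.down).2
    · exact fun hq => ⟨⟨ε ⟨q, hq⟩⟩, by simp [st]⟩
  have hex : ∀ y, ∃ φ, Shape.Named (Y := nameSet st) st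
      ((st y).formula.shape F₁ (st y).sign) φ := fun y =>
    Shape.exists_named (Y := nameSet st) (fun _ => rfl) (by
      rw [hrange]
      exact hQ _ (hrange.subset (Set.mem_range_self y)))
  choose F' hF' using hex
  have hname : ∀ x : X, ∃ y, st y = ⟨X.rank x, .var x rfl, .pos⟩ := fun x => by
    rw [← Set.mem_range, hrange]
    exact hvar x .pos
  choose ι hι using hname
  have hinj : Function.Injective ι := by
    intro x y hxy
    have h : (⟨X.rank x, .var x rfl, .pos⟩ : SignedFormula Voc X) =
        ⟨X.rank y, .var y rfl, .pos⟩ := by rw [← hι, ← hι, hxy]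
    have aux : ∀ {m n : ℕ} {hx : X.rank x = m} {hy : X.rank y = n},
        (⟨m, .var x hx, .pos⟩ : SignedFormula Voc X) = ⟨n, .var y hy, .pos⟩ → x = y := by
      intro m n hx hy h
      cases h
      rfl
    exact aux h
  have hrank : ∀ x, (nameSet st).rank (ι x) = X.rank x := fun x =>
    congrArg SignedFormula.type (hι x)
  have key : ∀ (x : X) (G : Graph Voc) (h' : G.front.length = (nameSet st).rank (ι x))
      (h : G.front.length = X.rank x) (b : Bool),
      value (X := nameSet st) F' (ι x) ⟨G, h'⟩ = some b ↔ value F x ⟨G, h⟩ = some b := by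
    intro x G h' h b
    rw [value_eq_some_iff, value_eq_some_iff]
    refine Iff.trans ?_ val_normalize
    refine Iff.trans ?_ (val_shapeGraph_iff (c := (initConfig x ⟨G, h⟩).normalize)
      (fun x => (F x).consuming_normalize) trivial)
    refine Iff.trans ?_ (val_named hst hF' (hι x) (hrank x) (G := ⟨G, h⟩))
    rw [initConfig, val_var, val_var]
  refine ⟨nameSet st, ⟨ι, hinj⟩, F', hrank, fun x => ⟨?_, ?_⟩, fun y => (hF' y).isShallow⟩
  · ext G
    constructor
    · rintro ⟨h, hv⟩
      exact ⟨h.trans (hrank x), (key x G h _ true).1 hv⟩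
    · rintro ⟨h, hv⟩
      exact ⟨h.trans (hrank x).symm, (key x G _ h true).2 hv⟩
  · ext G
    constructor
    · rintro ⟨h, hv⟩
      exact ⟨h.trans (hrank x), fun hf => hv ((key x G h _ false).2 hf)⟩
    · rintro ⟨h, hv⟩
      exact ⟨h.trans (hrank x).symm, fun hf => hv ((key x G _ h false).1 hf)⟩
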